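/- Let $d\ge 1$ and let $p$ be the step distribution of an irreducible random walk on $\mathbb{Z}^d$ with finite range: $p:\mathbb{Z}^d\to[0,\infty)$ has finite support $\mathcal V=\{v: p(v)>0\}$ and $\sum_v p(v)=1$. Let $p(0;x)=1$ if $x=0$ and $p(0;x)=0$ otherwise, and $p(n+1;x)=\sum_{y}p(n;y)\,p(x-y)$; irreducible means that for every $x\in\mathbb{Z}^d$ there is $n\ge 1$ with $p(n;x)>0$. Let $r=\gcd\{n\ge 1: p(n;0)>0\}$ be the period, and for $0\le j<r$ let $X_j=\{x\in\mathbb{Z}^d: p(j+kr;x)>0 \text{ for some } k\ge 0\}$. Let $\mathcal M\subset\mathbb{R}^d$ be the interior of the convex hull of $\mathcal V$, $\kappa(u)=\sum_{v\in\mathcal V}p(v)e^{\langle u,v\rangle}$ for $u\in\mathbb{R}^d$, $\delta_0=\sum_{v\in\mathcal V}p(v)\,v$ the mean step, and $B_0$ the quadratic form $B_0(u,u)=D_u^2\log\kappa(0)$, with $\det B_0$ the determinant of its matrix in the standard basis. For $\delta\in\mathcal M$ let $\phi(\delta)=\max\{\langle u,\delta\rangle-\log\kappa(u):u\in\mathbb{R}^d\}$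 (the maximum is attained). For every $\epsilon>0$ there is a constant $C>0$, depending only on $p$ and $\epsilon$, such that for all $j\in\{0,\dots,r-1\}$, $n\ge 1$ and $x\in X_j$, with $\delta=x/n$: (i) if $n\equiv j \pmod r$, $\delta\in\mathcal M$ and $\operatorname{dist}(\delta,\partial\mathcal M)\ge\epsilon$, then $$p(n;x)=(2\pi n)^{-d/2}(\det B_0)^{-1/2}e^{-n\phi(\delta)}\,(r+E_1+E_2)$$ for some real numbers $E_1,E_2$ with $|E_1|\le C\|\delta-\delta_0\|_1$ and $|E_2|\le C n^{-1}$; (ii) if $n\equiv j\pmod r$, $\delta\notin\mathcal M$ and $\operatorname{dist}(\delta,\partial\mathcal M)\ge\epsilon$, then $p(n;x)=0$; (iii) if $n\not\equiv j\pmod r$, then $p(n;x)=0$. -/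

import Mathlib

open scoped RealInnerProductSpace

/-- The step distribution of a random walk on `ℤ^d` with finite range: a finitely supported
probability mass function, `step v = p(v)`. -/
structure LatticeWalk (d : ℕ) where
  /-- The one-step transition density `p(v) = p(0, v)`. -/
  step : (Fin d → ℤ) →₀ ℝ
  step_nonneg : ∀ v, 0 ≤ step v
  sum_step : (∑ v ∈ step.support, step v) = 1

namespace LatticeWalk

noncomputable section

variable {d : ℕ}

/-- The inclusion `ℤ^d ⊆ ℝ^d`, with `ℝ^d` carrying the Euclidean structure. -/
def toSpace (v : Fin d → ℤ) : EuclideanSpace ℝ (Fin d) :=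
  WithLp.toLp 2 (fun i => (v i : ℝ))

/-- The `n`-step transition function `p(n; x)`:
`p(0; ·)` is the unit mass at the origin and `p(n+1; x) = ∑_y p(n; y) p(x - y)`
(a finite sum, because the step distribution is finitely supported). -/
def prob (W : LatticeWalk d) : ℕ → (Fin d → ℤ) → ℝ
  | 0, x => if x = 0 then 1 else 0
  | n + 1, x => ∑' y : Fin d → ℤ, prob W n y * W.step (x - y)

/-- Irreducibility: every site is reached with positive probability at some positive time. -/
def Irred (W : LatticeWalk d) : Prop :=
  ∀ x : Fin d → ℤ, ∃ n : ℕ, 1 ≤ n ∧ 0 < W.prob n x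

/-- The period `r = gcd {n ≥ 1 : p(n; 0) > 0}`. -/
def period (W : LatticeWalk d) : ℕ :=
  Nat.setGcd {n : ℕ | 1 ≤ n ∧ 0 < W.prob n 0}

/-- The class `X_j = {x : p(j + k r; x) > 0 for some k ≥ 0}`. -/
def cyclicClass (W : LatticeWalk d) (j : ℕ) : Set (Fin d → ℤ) :=
  {x | ∃ k : ℕ, 0 < W.prob (j + k * W.period) x}

/-- `κ(x) = ∑_{v ∈ V} p(v) e^{⟨x, v⟩}` for real `x`, where `V` is the support of `p`. -/
def kappa (W : LatticeWalk d) (x : EuclideanSpace ℝ (Fin d)) : ℝ :=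
  ∑ v ∈ W.step.support, W.step v * Real.exp ⟪x, toSpace v⟫

/-- `M`, the interior of the convex hull of the support `V` in `ℝ^d`. -/
def region (W : LatticeWalk d) : Set (EuclideanSpace ℝ (Fin d)) :=
  interior (convexHull ℝ (toSpace '' {v : Fin d → ℤ | 0 < W.step v}))

/-- The rate function `φ(δ) = max {⟨x, δ⟩ - log κ(x) : x ∈ ℝ^d}`, used for `δ ∈ M`. -/
def phi (W : LatticeWalk d) (δ : EuclideanSpace ℝ (Fin d)) : ℝ :=
  sSup (Set.range fun x : EuclideanSpace ℝ (Fin d) => ⟪x, δ⟫ - Real.log (W.kappa x))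

/-- The symmetric bilinear form `B_x(u, u') = D_u D_{u'} log κ (x)`, whose quadratic form is
`B_x(u, u) = D_u² log κ (x)`. -/
def form (W : LatticeWalk d) (x u u' : EuclideanSpace ℝ (Fin d)) : ℝ :=
  lineDeriv ℝ (fun y => lineDeriv ℝ (fun z => Real.log (W.kappa z)) y u') x u

/-- `det B_x`: the determinant of the matrix of `B_x` in the standard basis of `ℝ^d`. -/
def formDet (W : LatticeWalk d) (x : EuclideanSpace ℝ (Fin d)) : ℝ :=
  (Matrix.of fun i j : Fin d =>
    W.form x (EuclideanSpace.single i 1) (EuclideanSpace.single j 1)).det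

/-- The mean step `δ₀ = ∑_{v ∈ V} p(v) v`. -/
def meanStep (W : LatticeWalk d) : EuclideanSpace ℝ (Fin d) :=
  ∑ v ∈ W.step.support, W.step v • toSpace v

/-- The norm `‖u‖₁ = ∑ |u_i|`. -/
def norm1 (u : EuclideanSpace ℝ (Fin d)) : ℝ := ∑ i, |u i|

end

end LatticeWalk

/-! ### Path positivity, the period and the support of the transition function. -/

namespace LatticeWalk

variable {d : ℕ}

/-! The proof combines exponential tilting (Cramér) with a uniform local central limit theorem. Let
`s` maximise `⟨u, δ⟩ - log κ(u)`. The walk with steps `p(v) e^{⟨s, v⟩} / κ(s)` has mean `δ`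
(`mean_tilt_of_isMax`), and every path from `0` to `x` is reweighted by the same factor, so `p(n;
x)` is exactly `e^{-nφ(δ)}` times the tilted probability (`prob_tilt`). It remains to evaluate
tilted walks at their own mean.

For this (`exists_abs_prob_mul_sub_le`) Fourier inversion is used on the torus. The characteristic
function has modulus one at exactly `r` points, and the integrand is invariant under translation by
them. Hence the integral is `r` times its part near the origin, up to an exponentially small error.
Near the origin the rescaled integrand is a Gaussian times a phase of cubic order. Only the real
part matters, which makes the phase a second-order effect, so the error is `O(1/n)` and not
`O(n^{-1/2})`. All constants depend only on the support and on a lower bound for the step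
probabilities. When `δ` stays `ε` away from the boundary, `s` stays bounded (`exists_maximizer`), so
one such lower bound serves all the tilts.

The main term is then `r (det B_s)^{-1/2}`, because the Hessian of `log κ` at `s` is the tilted
covariance (`form_single`). Replacing `B_s` by `B_0` costs `O(‖s‖)`, and strong monotonicity of the
gradient of `log κ` gives `‖s‖ = O(‖δ - δ₀‖₁)` (`exists_norm_le_norm1`); this is `E₁`, and the local
limit error is `E₂`.

The vanishing statements are elementary: `x/n` lies in the convex hull of the steps if `p(n; x) >
0`, and the times at which `x` is reached agree modulo `r`. -/

theorem prob_succ (W : LatticeWalk d) (n : ℕ) (x : Fin d → ℤ) :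
    W.prob (n + 1) x = ∑ v ∈ W.step.support, W.step v * W.prob n (x - v) := by
  have h : W.prob (n + 1) x = ∑' y, W.prob n y * W.step (x - y) := by rw [prob]
  rw [h, ← (Equiv.subLeft x).tsum_eq, tsum_eq_sum (s := W.step.support)]
  · exact Finset.sum_congr rfl fun v _ => by simp [mul_comm]
  · intro v hv
    simp [Finsupp.notMem_support_iff.mp hv]

theorem prob_zero (W : LatticeWalk d) (x : Fin d → ℤ) :
    W.prob 0 x = if x = 0 then 1 else 0 := by rw [prob]

theorem step_pos (W : LatticeWalk d) {v : Fin d → ℤ} (hv : v ∈ W.step.support) :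
    0 < W.step v :=
  (W.step_nonneg v).lt_of_ne' (Finsupp.mem_support_iff.mp hv)

theorem prob_nonneg (W : LatticeWalk d) (n : ℕ) (x : Fin d → ℤ) : 0 ≤ W.prob n x := by
  induction n generalizing x with
  | zero => rw [prob_zero]; split_ifs <;> norm_num
  | succ n ih =>
    rw [prob_succ]
    exact Finset.sum_nonneg fun v _ => mul_nonneg (W.step_nonneg v) (ih _)

theorem prob_succ_pos_iff (W : LatticeWalk d) (n : ℕ) (x : Fin d → ℤ) :
    0 < W.prob (n + 1) x ↔ ∃ v ∈ W.step.support, 0 < W.prob n (x - v) := by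
  rw [prob_succ, Finset.sum_pos_iff_of_nonneg
    fun v _ => mul_nonneg (W.step_nonneg v) (W.prob_nonneg n _)]
  refine exists_congr fun v => and_congr_right fun hv => ?_
  exact mul_pos_iff_of_pos_left (W.step_pos hv)

theorem prob_zero_pos_iff (W : LatticeWalk d) (x : Fin d → ℤ) : 0 < W.prob 0 x ↔ x = 0 := by
  rw [prob_zero]; split_ifs with h <;> simp [h]

theorem prob_pos_add (W : LatticeWalk d) {m n : ℕ} {x y : Fin d → ℤ}
    (hx : 0 < W.prob m x) (hy : 0 < W.prob n y) : 0 < W.prob (m + n) (x + y) := by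
  induction n generalizing y with
  | zero => rw [prob_zero_pos_iff] at hy; simpa [hy] using hx
  | succ n ih =>
    obtain ⟨v, hv, h⟩ := (W.prob_succ_pos_iff n y).mp hy
    exact (W.prob_succ_pos_iff (m + n) (x + y)).mpr ⟨v, hv, by
      rw [add_sub_assoc]; exact ih h⟩

theorem support_nonempty (W : LatticeWalk d) : W.step.support.Nonempty := by
  rw [Finset.nonempty_iff_ne_empty]
  intro h
  have := W.sum_step
  simp [h] at this

theorem prob_one_pos (W : LatticeWalk d) {v : Fin d → ℤ} (hv : v ∈ W.step.support) :
    0 < W.prob 1 v :=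
  (W.prob_succ_pos_iff 0 v).mpr ⟨v, hv, by simp [prob_zero]⟩

theorem period_dvd (W : LatticeWalk d) {n : ℕ} (hn : 0 < W.prob n 0) : W.period ∣ n := by
  rcases Nat.eq_zero_or_pos n with rfl | h
  · simp
  · exact Nat.setGcd_dvd_of_mem ⟨h, hn⟩

theorem period_pos (W : LatticeWalk d) (hW : W.Irred) : 0 < W.period := by
  obtain ⟨n, hn, h⟩ := hW 0
  exact Nat.pos_of_dvd_of_pos (W.period_dvd h) hn

/-- One path from `x` back to the origin, of length `k`, completes both paths to loops, so `r`
divides `m + k` and `n + k`. -/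
theorem modEq_of_prob_pos (W : LatticeWalk d) (hW : W.Irred) {m n : ℕ} {x : Fin d → ℤ}
    (hm : 0 < W.prob m x) (hn : 0 < W.prob n x) : m ≡ n [MOD W.period] := by
  obtain ⟨k, -, hk⟩ := hW (-x)
  have h1 := W.period_dvd (by simpa using W.prob_pos_add hm hk)
  have h2 := W.period_dvd (by simpa using W.prob_pos_add hn hk)
  exact Nat.ModEq.add_right_cancel' k
    (((Nat.modEq_zero_iff_dvd).mpr h1).trans ((Nat.modEq_zero_iff_dvd).mpr h2).symm)

/-- The homomorphism `ℤ^d → ℤ/r` that sends `x` to the residue modulo the period `r` of the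
times at which `x` can be reached. -/
theorem exists_residueHom (W : LatticeWalk d) (hW : W.Irred) :
    ∃ h : (Fin d → ℤ) →+ ZMod W.period, ∀ n x, 0 < W.prob n x → h x = n := by
  have hW' := hW
  choose τ _ hτ using hW'
  have key : ∀ n x, 0 < W.prob n x → ((τ x : ℕ) : ZMod W.period) = n := fun n x hx =>
    (ZMod.natCast_eq_natCast_iff _ _ _).mpr (W.modEq_of_prob_pos hW (hτ x) hx)
  refine ⟨⟨⟨fun x => (τ x : ZMod W.period), ?_⟩, ?_⟩, key⟩
  · simpa using key 0 0 (by simp [prob_zero])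
  · intro x y
    have := key _ _ (W.prob_pos_add (hτ x) (hτ y))
    push_cast at this
    exact this

theorem prob_eq_zero_of_not_modEq (W : LatticeWalk d) (hW : W.Irred) {j n : ℕ}
    {x : Fin d → ℤ} (hx : x ∈ W.cyclicClass j) (hn : ¬ n ≡ j [MOD W.period]) :
    W.prob n x = 0 := by
  obtain ⟨k, hk⟩ := hx
  by_contra h
  refine hn ((W.modEq_of_prob_pos hW ((W.prob_nonneg n x).lt_of_ne' h) hk).trans ?_)
  simp [Nat.ModEq]

/-- If `p(n; x) > 0` and `n ≥ 1`, then `x / n` lies in the convex hull of the steps. -/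
theorem inv_smul_mem_convexHull (W : LatticeWalk d) {n : ℕ} (hn : 1 ≤ n) {x : Fin d → ℤ}
    (hx : 0 < W.prob n x) :
    (n : ℝ)⁻¹ • toSpace x ∈ convexHull ℝ (toSpace '' {v : Fin d → ℤ | 0 < W.step v}) := by
  set S := toSpace '' {v : Fin d → ℤ | 0 < W.step v}
  induction n, hn using Nat.le_induction generalizing x with
  | base =>
    obtain ⟨v, hv, h⟩ := (W.prob_succ_pos_iff 0 x).mp hx
    rw [prob_zero_pos_iff, sub_eq_zero] at h
    subst h
    simpa using subset_convexHull ℝ S ⟨x, W.step_pos hv, rfl⟩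
  | succ n hn ih =>
    obtain ⟨v, hv, h⟩ := (W.prob_succ_pos_iff n x).mp hx
    have hn' : (0 : ℝ) < n := by exact_mod_cast hn
    have h1 := ih h
    have h2 : toSpace v ∈ convexHull ℝ S := subset_convexHull ℝ S ⟨v, W.step_pos hv, rfl⟩
    have h3 := convex_convexHull ℝ S h1 h2 (a := n / (n + 1)) (b := 1 / (n + 1))
      (by positivity) (by positivity) (by field_simp)
    convert h3 using 1
    ext i
    simp [toSpace]
    field_simp
    ring

/-- A linear functional that is constant on the steps of an irreducible walk vanishes. -/
theorem eq_zero_of_constant_on_support (W : LatticeWalk d) (hW : W.Irred) (ω : Fin d → ℝ)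
    (c : ℝ) (h : ∀ v ∈ W.step.support, ∑ i, ω i * (v i : ℝ) = c) : ω = 0 := by
  have key : ∀ n x, 0 < W.prob n x → ∑ i, ω i * (x i : ℝ) = n * c := by
    intro n
    induction n with
    | zero => intro x hx; rw [prob_zero_pos_iff] at hx; simp [hx]
    | succ n ih =>
      intro x hx
      obtain ⟨v, hv, hx'⟩ := (W.prob_succ_pos_iff n x).mp hx
      have h1 := ih _ hx'
      simp only [Pi.sub_apply, Int.cast_sub, mul_sub, Finset.sum_sub_distrib, h v hv] at h1
      push_cast
      linarith
  -- A return to the origin at a positive time forces `c = 0`; since every basis vector is reached,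
  -- all coordinates of `ω` then vanish.
  obtain ⟨n, hn, h0⟩ := hW 0
  have hc : c = 0 := by
    have := key n 0 h0
    have hn' : (n : ℝ) ≠ 0 := by positivity
    simpa [hn'] using this
  ext i
  obtain ⟨m, -, hm⟩ := hW (Pi.single i 1)
  have := key m _ hm
  simpa [hc, Pi.single_apply] using this

end LatticeWalk

/-! ### Characters of the torus, Fourier inversion and the modulus of the characteristic function.
-/

namespace LatticeWalk

open MeasureTheory

variable {d : ℕ}

/-- The character `θ ↦ e^{2πi⟨x, θ⟩}` of the torus `(ℝ/ℤ)^d`. -/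
noncomputable def chi (x : Fin d → ℤ) (θ : Fin d → UnitAddCircle) : ℂ :=
  ((∑ i, x i • θ i : UnitAddCircle).toCircle : ℂ)

theorem chi_add_left (x y : Fin d → ℤ) (θ : Fin d → UnitAddCircle) :
    chi (x + y) θ = chi x θ * chi y θ := by
  simp [chi, add_smul, Finset.sum_add_distrib, AddCircle.toCircle_add]

theorem chi_add_right (x : Fin d → ℤ) (θ η : Fin d → UnitAddCircle) :
    chi x (θ + η) = chi x θ * chi x η := by
  simp [chi, smul_add, Finset.sum_add_distrib, AddCircle.toCircle_add]

@[simp] theorem chi_zero_left (θ : Fin d → UnitAddCircle) : chi 0 θ = 1 := by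
  simp [chi]

@[simp] theorem norm_chi (x : Fin d → ℤ) (θ : Fin d → UnitAddCircle) : ‖chi x θ‖ = 1 :=
  Circle.norm_coe _

theorem chi_neg_left (x : Fin d → ℤ) (θ : Fin d → UnitAddCircle) :
    chi (-x) θ = (starRingEnd ℂ) (chi x θ) := by
  simp [chi, AddCircle.toCircle_neg, ← Circle.coe_inv_eq_conj]

theorem chi_sub_left (x y : Fin d → ℤ) (θ : Fin d → UnitAddCircle) :
    chi (x - y) θ = chi x θ * (starRingEnd ℂ) (chi y θ) := by
  rw [sub_eq_add_neg, chi_add_left, chi_neg_left]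

theorem continuous_chi (x : Fin d → ℤ) : Continuous (chi x) := by
  unfold chi
  exact continuous_subtype_val.comp (AddCircle.continuous_toCircle.comp (by fun_prop))

theorem chi_mk (x : Fin d → ℤ) (ω : Fin d → ℝ) :
    chi x (fun i => (ω i : UnitAddCircle)) =
      Complex.exp (2 * Real.pi * (∑ i, ω i * (x i : ℝ) : ℝ) * Complex.I) := by
  have : (∑ i, x i • (ω i : UnitAddCircle) : UnitAddCircle) =
      ((∑ i, ω i * (x i : ℝ) : ℝ) : UnitAddCircle) := by
    rw [← QuotientAddGroup.mk'_apply, map_sum]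
    exact Finset.sum_congr rfl fun i _ => by
      rw [QuotientAddGroup.mk'_apply, ← AddCircle.coe_zsmul, zsmul_eq_mul, mul_comm]
  rw [chi, this, AddCircle.toCircle_apply_mk, Circle.coe_exp]
  simp

instance isProbabilityMeasure_unitAddCircle :
    IsProbabilityMeasure (volume : Measure UnitAddCircle) := ⟨UnitAddCircle.measure_univ⟩

theorem integrable_of_continuous {F : (Fin d → UnitAddCircle) → ℂ} (hF : Continuous F) :
    Integrable F := by
  simpa using hF.continuousOn.integrableOn_compact (μ := volume) isCompact_univ

theorem integral_chi (x : Fin d → ℤ) :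
    ∫ θ : Fin d → UnitAddCircle, chi x θ = if x = 0 then 1 else 0 := by
  split_ifs with h
  · subst h; simp
  · obtain ⟨i, hi⟩ := Function.ne_iff.mp h
    have hi' : (x i : ℝ) ≠ 0 := by exact_mod_cast hi
    -- Translation by `t` multiplies the character by `-1`, so its integral equals its own negative.
    set t : Fin d → ℝ := Pi.single i (1 / (2 * x i)) with ht
    have h1 : chi x (fun i => (t i : UnitAddCircle)) = -1 := by
      rw [chi_mk, ← Complex.exp_pi_mul_I]
      congr 1
      have : ∑ j, t j * (x j : ℝ) = 1 / 2 := by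
        rw [Finset.sum_eq_single i]
        · simp [ht]; field_simp
        · intro j _ hj; simp [ht, hj]
        · simp
      rw [this]; push_cast; ring
    have h2 := integral_add_right_eq_self (μ := (volume : Measure (Fin d → UnitAddCircle)))
      (chi x) (fun i => (t i : UnitAddCircle))
    simp only [chi_add_right, h1, mul_neg, mul_one, integral_neg] at h2
    linear_combination (-1 / 2 : ℂ) * h2

/-- The characteristic function of the step distribution. -/
noncomputable def charFn (W : LatticeWalk d) (θ : Fin d → UnitAddCircle) : ℂ :=
  ∑ v ∈ W.step.support, (W.step v : ℂ) * chi v θ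

theorem continuous_charFn (W : LatticeWalk d) : Continuous W.charFn := by
  unfold charFn
  exact continuous_finsetSum _ fun v _ => continuous_const.mul (continuous_chi v)

/-- Fourier inversion for the `n`-step transition function. -/
theorem prob_eq_integral (W : LatticeWalk d) (n : ℕ) (x : Fin d → ℤ) :
    (W.prob n x : ℂ) = ∫ θ, W.charFn θ ^ n * chi (-x) θ := by
  induction n generalizing x with
  | zero =>
    simp only [pow_zero, one_mul, integral_chi, prob_zero, neg_eq_zero]
    split_ifs <;> simp
  | succ n ih =>
    have h : ∀ θ, W.charFn θ ^ (n + 1) * chi (-x) θ = ∑ v ∈ W.step.support,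
        (W.step v : ℂ) * (W.charFn θ ^ n * chi (-(x - v)) θ) := by
      intro θ
      have : ∀ v, chi (-(x - v)) θ = chi v θ * chi (-x) θ := fun v => by
        rw [← chi_add_left]; congr 1; abel
      simp only [this]
      rw [pow_succ]
      conv_lhs => rw [charFn, mul_assoc, Finset.sum_mul, Finset.mul_sum]
      exact Finset.sum_congr rfl fun v _ => by rw [charFn]; ring
    simp_rw [h]
    rw [integral_finsetSum, prob_succ]
    · push_cast
      exact Finset.sum_congr rfl fun v _ => by rw [integral_const_mul, ih]
    · intro v _
      exact integrable_of_continuous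
        (continuous_const.mul ((W.continuous_charFn.pow n).mul (continuous_chi _)))

theorem sum_step_mul_sum_step (W : LatticeWalk d) :
    ∑ v ∈ W.step.support, ∑ v' ∈ W.step.support, W.step v * W.step v' = 1 := by
  rw [← Finset.sum_mul_sum, W.sum_step, one_mul]

theorem norm_charFn_sq (W : LatticeWalk d) (θ : Fin d → UnitAddCircle) :
    ‖W.charFn θ‖ ^ 2 = 1 - ∑ v ∈ W.step.support, ∑ v' ∈ W.step.support,
      W.step v * W.step v' * (1 - (chi (v - v') θ).re) := by
  have h : ((‖W.charFn θ‖ ^ 2 : ℝ) : ℂ) = ∑ v ∈ W.step.support, ∑ v' ∈ W.step.support,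
      (W.step v * W.step v' : ℂ) * chi (v - v') θ := by
    rw [Complex.ofReal_pow, ← Complex.mul_conj', charFn, map_sum, Finset.sum_mul_sum]
    refine Finset.sum_congr rfl fun v _ => Finset.sum_congr rfl fun v' _ => ?_
    rw [chi_sub_left, map_mul, Complex.conj_ofReal]
    ring
  have h2 := congrArg Complex.re h
  rw [Complex.ofReal_re] at h2
  rw [h2]
  simp only [mul_sub, mul_one, Finset.sum_sub_distrib, sum_step_mul_sum_step, Complex.re_sum]
  rw [sub_sub_cancel]
  refine Finset.sum_congr rfl fun v _ => Finset.sum_congr rfl fun v' _ => ?_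
  rw [← Complex.ofReal_mul, Complex.re_ofReal_mul]

/-- The function that measures how far `θ` is from annihilating all differences of steps. -/
noncomputable def defect (V : Finset (Fin d → ℤ)) (θ : Fin d → UnitAddCircle) : ℝ :=
  ∑ v ∈ V, ∑ v' ∈ V, (1 - (chi (v - v') θ).re)

theorem re_chi_le_one (x : Fin d → ℤ) (θ : Fin d → UnitAddCircle) : (chi x θ).re ≤ 1 :=
  (Complex.re_le_norm _).trans (norm_chi x θ).le

theorem continuous_defect (V : Finset (Fin d → ℤ)) : Continuous (defect V) := by
  unfold defect
  refine continuous_finsetSum _ fun v _ => continuous_finsetSum _ fun v' _ => ?_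
  exact continuous_const.sub (Complex.continuous_re.comp (continuous_chi _))

theorem defect_nonneg (V : Finset (Fin d → ℤ)) (θ : Fin d → UnitAddCircle) : 0 ≤ defect V θ :=
  Finset.sum_nonneg fun _ _ => Finset.sum_nonneg fun _ _ => sub_nonneg.mpr (re_chi_le_one _ _)

/-- Separates weights from geometry: `defect` sees only the support, so the bound is uniform over
all walks with these steps and weights at least `q`. -/
theorem norm_charFn_sq_le (W : LatticeWalk d) {q : ℝ} (hq : 0 ≤ q)
    (hs : ∀ v ∈ W.step.support, q ≤ W.step v) (θ : Fin d → UnitAddCircle) :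
    ‖W.charFn θ‖ ^ 2 ≤ 1 - q ^ 2 * defect W.step.support θ := by
  rw [norm_charFn_sq, defect, Finset.mul_sum]
  gcongr with v hv
  rw [Finset.mul_sum]
  gcongr with v' hv'
  · exact sub_nonneg.mpr (re_chi_le_one _ _)
  · rw [sq]
    exact mul_le_mul (hs v hv) (hs v' hv') hq (W.step_nonneg v)

/-- The points of the torus at which the characteristic function has modulus one. -/
noncomputable def peak {r : ℕ} [NeZero r] (h : (Fin d → ℤ) →+ ZMod r) (k : ZMod r) :
    Fin d → UnitAddCircle :=
  fun i => ZMod.toAddCircle (k * h (Pi.single i 1))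

theorem chi_peak {r : ℕ} [NeZero r] (h : (Fin d → ℤ) →+ ZMod r) (k : ZMod r)
    (x : Fin d → ℤ) : chi x (peak h k) = ZMod.stdAddChar (k * h x) := by
  have hx : h x = ∑ i, x i • h (Pi.single i 1) := by
    conv_lhs => rw [← Finset.univ_sum_single x, map_sum]
    refine Finset.sum_congr rfl fun i _ => ?_
    rw [← map_zsmul, ← Pi.single_smul]
    simp
  have h1 : (∑ i, x i • peak h k i : UnitAddCircle) = ZMod.toAddCircle (k * h x) := by
    rw [hx, Finset.mul_sum, map_sum]
    refine Finset.sum_congr rfl fun i _ => ?_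
    rw [peak, ← map_zsmul]
    congr 1
    simp only [zsmul_eq_mul]
    ring
  rw [chi, h1, ZMod.stdAddChar_apply, ZMod.toCircle, AddChar.compAddMonoidHom_apply]
  rfl

end LatticeWalk

/-! ### The peaks of the characteristic function and localisation at the origin. -/

namespace LatticeWalk

open MeasureTheory

variable {d : ℕ}

theorem chi_eq_one_of_re_eq_one (x : Fin d → ℤ) (θ : Fin d → UnitAddCircle)
    (h : (chi x θ).re = 1) : chi x θ = 1 := by
  have h1 := Complex.sq_norm (chi x θ)
  rw [norm_chi, Complex.normSq_apply, h] at h1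
  have h2 : (chi x θ).im = 0 := by nlinarith
  exact Complex.ext (by simpa using h) (by simpa using h2)

theorem chi_eq_of_defect_eq_zero {V : Finset (Fin d → ℤ)} {θ : Fin d → UnitAddCircle}
    (h : defect V θ = 0) {v v' : Fin d → ℤ} (hv : v ∈ V) (hv' : v' ∈ V) :
    chi v θ = chi v' θ := by
  have hn : ∀ v v', 0 ≤ 1 - (chi (v - v') θ).re := fun _ _ => sub_nonneg.mpr (re_chi_le_one _ _)
  have h1 := (Finset.sum_eq_zero_iff_of_nonneg
    fun _ _ => Finset.sum_nonneg fun _ _ => hn _ _).mp h v hv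
  have h2 := (Finset.sum_eq_zero_iff_of_nonneg fun _ _ => hn _ _).mp h1 v' hv'
  have h3 := chi_eq_one_of_re_eq_one (v - v') θ (by linarith)
  have : chi (v - v') θ * chi v' θ = chi v θ := by rw [← chi_add_left, sub_add_cancel]
  rw [← this, h3, one_mul]

theorem chi_eq_pow_of_prob_pos (W : LatticeWalk d) {θ : Fin d → UnitAddCircle} {ζ : ℂ}
    (hζ : ∀ v ∈ W.step.support, chi v θ = ζ) (n : ℕ) (x : Fin d → ℤ) (hx : 0 < W.prob n x) :
    chi x θ = ζ ^ n := by
  induction n generalizing x with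
  | zero => rw [prob_zero_pos_iff] at hx; simp [hx]
  | succ n ih =>
    obtain ⟨v, hv, h⟩ := (W.prob_succ_pos_iff n x).mp hx
    rw [pow_succ, ← ih _ h, ← hζ v hv, ← chi_add_left, sub_add_cancel]

/-- Zero defect means that all steps share one character value `ζ`, so the character at a point
reached at time `n` is `ζ ^ n`. Return times give `ζ ^ r = 1`, hence `ζ` is the value at some `k` of
the standard character of `ℤ/r`, and the values at the basis vectors determine `θ`. -/
theorem eq_peak_of_defect_eq_zero (W : LatticeWalk d) (hW : W.Irred) [NeZero W.period]
    (h : (Fin d → ℤ) →+ ZMod W.period) (hh : ∀ n x, 0 < W.prob n x → h x = n)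
    {θ : Fin d → UnitAddCircle} (hθ : defect W.step.support θ = 0) : ∃ k, θ = peak h k := by
  obtain ⟨v₀, hv₀⟩ := W.support_nonempty
  set ζ := chi v₀ θ with hζ
  have key := W.chi_eq_pow_of_prob_pos (ζ := ζ)
    fun v hv => chi_eq_of_defect_eq_zero hθ hv hv₀
  have hr : ζ ^ W.period = 1 := by
    rw [← orderOf_dvd_iff_pow_eq_one, period, Nat.dvd_setGcd_iff]
    rintro m ⟨-, hm⟩
    rw [orderOf_dvd_iff_pow_eq_one, ← key m 0 hm, chi_zero_left]
  obtain ⟨i, -, hi⟩ := (Complex.isPrimitiveRoot_exp _ (NeZero.ne W.period)).eq_pow_of_pow_eq_one hr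
  have hk : ZMod.stdAddChar ((i : ℕ) : ZMod W.period) = ζ := by
    have := ZMod.stdAddChar_coe (N := W.period) i
    rw [Int.cast_natCast] at this
    rw [this, ← hi, ← Complex.exp_nat_mul]
    congr 1
    push_cast
    ring
  refine ⟨(i : ZMod W.period), funext fun j => ?_⟩
  obtain ⟨n, -, hn⟩ := hW (Pi.single j 1)
  have h1 : chi (Pi.single j 1) θ = chi (Pi.single j 1) (peak h (i : ZMod W.period)) := by
    rw [key n _ hn, chi_peak, hh n _ hn, mul_comm, ← nsmul_eq_mul, AddChar.map_nsmul_eq_pow, hk]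
  have h2 : ∀ η : Fin d → UnitAddCircle,
      chi (Pi.single j 1) η = ((η j).toCircle : ℂ) := fun η => by
    rw [chi, Finset.sum_eq_single j]
    · simp
    · intro b _ hb; simp [hb]
    · simp
  rw [h2, h2] at h1
  exact AddCircle.injective_toCircle one_ne_zero (Subtype.ext h1)

theorem peak_injective (W : LatticeWalk d) [NeZero W.period]
    (h : (Fin d → ℤ) →+ ZMod W.period) (hh : ∀ n x, 0 < W.prob n x → h x = n) :
    Function.Injective (peak h) := by
  intro k k' hkk
  obtain ⟨v, hv⟩ := W.support_nonempty
  have h1 : h v = 1 := by simpa using hh 1 v (W.prob_one_pos hv)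
  have h2 := congrArg (chi v) hkk
  rw [chi_peak, chi_peak, h1, mul_one, mul_one] at h2
  exact ZMod.injective_stdAddChar h2

/-- The integrand of the inversion formula is invariant under translation by peaks. -/
theorem integrand_add_peak (W : LatticeWalk d) {r : ℕ} [NeZero r]
    (h : (Fin d → ℤ) →+ ZMod r) (hh : ∀ v ∈ W.step.support, h v = 1) (k : ZMod r)
    {n : ℕ} {x : Fin d → ℤ} (hx : h x = n) (θ : Fin d → UnitAddCircle) :
    W.charFn (θ + peak h k) ^ n * chi (-x) (θ + peak h k) = W.charFn θ ^ n * chi (-x) θ := by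
  have h1 : W.charFn (θ + peak h k) = W.charFn θ * ZMod.stdAddChar k := by
    rw [charFn, charFn, Finset.sum_mul]
    refine Finset.sum_congr rfl fun v hv => ?_
    rw [chi_add_right, chi_peak, hh v hv, mul_one, mul_assoc]
  -- The phase gained by the `n`-th power cancels that of `chi (-x)` precisely because `h x = n`.
  have h2 : (ZMod.stdAddChar k : ℂ) ^ n * ZMod.stdAddChar (k * h (-x)) = 1 := by
    rw [← AddChar.map_nsmul_eq_pow, ← AddChar.map_add_eq_mul, map_neg, hx, nsmul_eq_mul]
    simp [mul_comm]
  rw [h1, chi_add_right, chi_peak, mul_pow]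
  linear_combination (W.charFn θ ^ n * chi (-x) θ) * h2

theorem exists_separating_radius {α : Type*} [MetricSpace α] {ι : Type*} [Finite ι]
    {g : ι → α} (hg : Function.Injective g) {ρ : ℝ} (hρ : 0 < ρ) :
    ∃ η, 0 < η ∧ η ≤ ρ ∧ Pairwise fun i j => Disjoint (Metric.ball (g i) η)
      (Metric.ball (g j) η) := by
  have h1 : ∀ᶠ η in nhdsWithin (0 : ℝ) (Set.Ioi 0),
      ∀ i j, i ≠ j → η + η ≤ dist (g i) (g j) := by
    refine Filter.eventually_all.mpr fun i => Filter.eventually_all.mpr fun j => ?_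
    by_cases hij : i = j
    · simp [hij]
    · have : 0 < dist (g i) (g j) := dist_pos.mpr (hg.ne hij)
      filter_upwards [Ioo_mem_nhdsGT (half_pos this)] with η hη _
      linarith [hη.2]
  obtain ⟨η, h2, h3⟩ := (h1.and (Ioo_mem_nhdsGT hρ)).exists
  exact ⟨η, h3.1, h3.2.le, fun i j hij => Metric.ball_disjoint_ball (h2 i j hij)⟩

/-- By invariance the disjoint balls contribute equally; what is left has measure at most one, and
the integrand there is at most `γ`. -/
theorem norm_integral_sub_card_mul_le {ι : Type*} [Fintype ι] {F : (Fin d → UnitAddCircle) → ℂ}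
    (hF : Continuous F) {g : ι → Fin d → UnitAddCircle} {η : ℝ}
    (hg : Pairwise fun i j => Disjoint (Metric.ball (g i) η) (Metric.ball (g j) η))
    (hinv : ∀ i θ, F (θ + g i) = F θ) {γ : ℝ}
    (hγ : ∀ θ, (∀ i, θ ∉ Metric.ball (g i) η) → ‖F θ‖ ≤ γ) (hγ0 : 0 ≤ γ) :
    ‖(∫ θ, F θ) - Fintype.card ι * ∫ θ in Metric.ball 0 η, F θ‖ ≤ γ := by
  have hball : ∀ i, ∫ θ in Metric.ball (g i) η, F θ = ∫ θ in Metric.ball 0 η, F θ := by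
    intro i
    rw [← integral_indicator Metric.isOpen_ball.measurableSet,
      ← integral_indicator Metric.isOpen_ball.measurableSet,
      ← integral_add_right_eq_self _ (g i)]
    congr 1
    ext θ
    simp only [Set.indicator, Metric.mem_ball, hinv,
      dist_eq_norm, add_sub_cancel_right, sub_zero]
  have hm : MeasurableSet (⋃ i, Metric.ball (g i) η) :=
    MeasurableSet.iUnion fun i => Metric.isOpen_ball.measurableSet
  have hint := integrable_of_continuous hF
  have h1 := integral_add_compl hm hint
  rw [integral_iUnion_fintype (fun i => Metric.isOpen_ball.measurableSet) hg
    fun i => hint.integrableOn] at h1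
  simp only [hball, Finset.sum_const, Finset.card_univ, nsmul_eq_mul] at h1
  rw [← h1, add_sub_cancel_left]
  refine (norm_setIntegral_le_of_norm_le_const (C := γ) (measure_lt_top _ _) ?_).trans ?_
  · intro θ hθ
    exact hγ θ (by simpa using hθ)
  · exact mul_le_of_le_one_right hγ0 measureReal_le_one

/-- Integration over a small ball of the torus, lifted to `ℝ^d`. -/
theorem setIntegral_ball_torus {F : (Fin d → UnitAddCircle) → ℂ} (hF : Continuous F) {η : ℝ}
    (hη0 : 0 < η) (hη : η < 1 / 2) :
    ∫ θ in Metric.ball 0 η, F θ =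
      ∫ ω : Fin d → ℝ in Metric.ball 0 η, F (fun i => (ω i : UnitAddCircle)) := by
  have hmp : MeasurePreserving (fun (ω : Fin d → ℝ) (i : Fin d) => (ω i : UnitAddCircle))
      (Measure.pi fun _ => volume.restrict (Set.Ioc (-(1 / 2) : ℝ) (-(1 / 2) + 1)))
      (volume : Measure (Fin d → UnitAddCircle)) :=
    measurePreserving_pi _ _ fun _ => UnitAddCircle.measurePreserving_mk _
  have hball : MeasurableSet (Metric.ball (0 : Fin d → UnitAddCircle) η) :=
    Metric.isOpen_ball.measurableSet
  rw [← integral_indicator hball, ← hmp.map_eq, integral_map hmp.measurable.aemeasurable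
    (hF.stronglyMeasurable.indicator hball).aestronglyMeasurable, ← Measure.restrict_pi_pi]
  have hbox : MeasurableSet (Set.univ.pi fun _ : Fin d => Set.Ioc (-(1 / 2) : ℝ) (-(1 / 2) + 1)) :=
    MeasurableSet.univ_pi fun _ => measurableSet_Ioc
  rw [← integral_indicator hbox, ← integral_indicator Metric.isOpen_ball.measurableSet]
  congr 1
  ext ω
  -- On the fundamental box the quotient norm of each coordinate is its absolute value, so balls of
  -- radius below `1/2` correspond.
  have hiff : (ω ∈ (Set.univ.pi fun _ : Fin d => Set.Ioc (-(1 / 2) : ℝ) (-(1 / 2) + 1)) ∧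
      (fun i => (ω i : UnitAddCircle)) ∈ Metric.ball (0 : Fin d → UnitAddCircle) η) ↔
      ω ∈ Metric.ball (0 : Fin d → ℝ) η := by
    simp only [Metric.mem_ball, dist_zero_right, pi_norm_lt_iff hη0, Set.mem_univ_pi, Set.mem_Ioc]
    have habs : ∀ t : ℝ, |t| ≤ 1 / 2 → ‖(t : UnitAddCircle)‖ = |t| := fun t ht =>
      (AddCircle.norm_coe_eq_abs_iff _ one_ne_zero).mpr (by simpa using ht)
    constructor
    · rintro ⟨h1, h2⟩ i
      rw [Real.norm_eq_abs, ← habs _ (abs_le.mpr ⟨(h1 i).1.le, by linarith [(h1 i).2]⟩)]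
      exact h2 i
    · intro h
      have h' : ∀ i, |ω i| < 1 / 2 := fun i => (h i).trans hη
      refine ⟨fun i => ?_, fun i => ?_⟩
      · have := abs_lt.mp (h' i)
        exact ⟨this.1, by linarith [this.2]⟩
      · rw [habs _ (h' i).le]; exact h i
  by_cases h1 : ω ∈ (Set.univ.pi fun _ : Fin d => Set.Ioc (-(1 / 2) : ℝ) (-(1 / 2) + 1))
  · by_cases h2 : (fun i => (ω i : UnitAddCircle)) ∈ Metric.ball (0 : Fin d → UnitAddCircle) η
    · rw [Set.indicator_of_mem h1, Set.indicator_of_mem h2, Set.indicator_of_mem (hiff.mp ⟨h1, h2⟩)]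
    · rw [Set.indicator_of_mem h1, Set.indicator_of_notMem h2,
        Set.indicator_of_notMem fun h => h2 (hiff.mpr h).2]
  · rw [Set.indicator_of_notMem h1, Set.indicator_of_notMem fun h => h1 (hiff.mpr h).1]

/-- The transition function is, up to an exponentially small error, `r` times the integral of
the inversion formula over a small neighbourhood of the origin. -/
theorem exists_norm_prob_sub_period_mul_le (W : LatticeWalk d) (hW : W.Irred) {q ρ : ℝ}
    (hq : 0 < q) (hρ : 0 < ρ) :
    ∃ η, 0 < η ∧ η ≤ ρ ∧ ∃ γ, 0 ≤ γ ∧ γ < 1 ∧ ∀ W' : LatticeWalk d,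
      W'.step.support = W.step.support → (∀ v ∈ W.step.support, q ≤ W'.step v) →
      ∀ m n x, 0 < W.prob m x → n ≡ m [MOD W.period] →
        ‖(W'.prob n x : ℂ) - W.period * ∫ ω : Fin d → ℝ in Metric.ball 0 η,
          W'.charFn (fun i => (ω i : UnitAddCircle)) ^ n *
            chi (-x) (fun i => (ω i : UnitAddCircle))‖ ≤ γ ^ n := by
  have : NeZero W.period := ⟨(W.period_pos hW).ne'⟩
  obtain ⟨h, hh⟩ := W.exists_residueHom hW
  obtain ⟨η, hη0, hηρ, hdisj⟩ := exists_separating_radius (W.peak_injective h hh)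
    (lt_min hρ (by norm_num : (0 : ℝ) < 1 / 4))
  have hcompact : IsCompact (⋃ k, Metric.ball (peak h k) η)ᶜ :=
    (isOpen_iUnion fun _ => Metric.isOpen_ball).isClosed_compl.isCompact
  obtain ⟨δ, hδ0, hδ⟩ := hcompact.exists_forall_le' (a := 0)
    (continuous_defect W.step.support).continuousOn fun θ hθ => by
      refine (defect_nonneg _ _).lt_of_ne' fun h0 => hθ ?_
      obtain ⟨k, rfl⟩ := W.eq_peak_of_defect_eq_zero hW h hh h0
      exact Set.mem_iUnion.mpr ⟨k, Metric.mem_ball_self hη0⟩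
  -- Off the balls around the peaks the defect is at least `δ` by compactness, so
  -- `norm_charFn_sq_le` bounds the modulus by this root.
  refine ⟨η, hη0, hηρ.trans (min_le_left _ _), √(1 - q ^ 2 * δ), Real.sqrt_nonneg _, ?_, ?_⟩
  · rw [Real.sqrt_lt' one_pos]
    nlinarith [mul_pos (pow_pos hq 2) hδ0]
  intro W' hsupp hW' m n x hm hn
  have hx : h x = n := by
    rw [hh m x hm, (ZMod.natCast_eq_natCast_iff _ _ _).mpr hn.symm]
  have hF : Continuous fun θ => W'.charFn θ ^ n * chi (-x) θ :=
    (W'.continuous_charFn.pow n).mul (continuous_chi _)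
  rw [prob_eq_integral, ← setIntegral_ball_torus hF hη0
    (by linarith [hηρ.trans (min_le_right ρ (1 / 4))])]
  have hmain := norm_integral_sub_card_mul_le hF hdisj
    (fun k θ => W'.integrand_add_peak h (fun v hv => by
      simpa using hh 1 v (W.prob_one_pos (hsupp ▸ hv))) k hx θ)
    (γ := √(1 - q ^ 2 * δ) ^ n) (fun θ hθ => ?_) (by positivity)
  · rwa [ZMod.card] at hmain
  · rw [norm_mul, norm_chi, mul_one, norm_pow]
    refine pow_le_pow_left₀ (norm_nonneg _) (Real.le_sqrt_of_sq_le ?_) n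
    refine (W'.norm_charFn_sq_le hq.le (by rwa [hsupp]) θ).trans ?_
    rw [hsupp]
    gcongr
    exact hδ θ (by simpa using hθ)

end LatticeWalk

/-! ### Taylor estimates for powers of a centred characteristic function. -/

namespace LatticeWalk

theorem norm_pow_sub_pow_le_mul {x y : ℂ} {M : ℝ} (hx : ‖x‖ ≤ M) (hy : ‖y‖ ≤ M) (n : ℕ) :
    ‖x ^ (n + 1) - y ^ (n + 1)‖ ≤ (n + 1) * M ^ n * ‖x - y‖ := by
  have hM : 0 ≤ M := (norm_nonneg _).trans hx
  induction n with
  | zero => simp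
  | succ n ih =>
    have : x ^ (n + 2) - y ^ (n + 2) = x * (x ^ (n + 1) - y ^ (n + 1)) + (x - y) * y ^ (n + 1) := by
      ring
    rw [this]
    refine (norm_add_le _ _).trans ?_
    rw [norm_mul, norm_mul, norm_pow]
    calc ‖x‖ * ‖x ^ (n + 1) - y ^ (n + 1)‖ + ‖x - y‖ * ‖y‖ ^ (n + 1)
        ≤ M * ((n + 1) * M ^ n * ‖x - y‖) + ‖x - y‖ * M ^ (n + 1) := by gcongr
      _ = _ := by push_cast; ring

theorem norm_exp_sub_cubic_le {a : ℝ} (ha : |a| ≤ 1) :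
    ‖Complex.exp (a * Complex.I) - (1 + a * Complex.I - a ^ 2 / 2 - a ^ 3 / 6 * Complex.I)‖
      ≤ a ^ 4 := by
  have hn : ‖(a : ℂ) * Complex.I‖ = |a| := by simp
  have h := Complex.exp_bound (x := a * Complex.I) (by rwa [hn]) (n := 4) (by norm_num)
  rw [hn] at h
  have h1 : ∑ m ∈ Finset.range 4, (a * Complex.I : ℂ) ^ m / (m.factorial : ℂ) =
      1 + a * Complex.I - a ^ 2 / 2 - a ^ 3 / 6 * Complex.I := by
    simp only [Finset.sum_range_succ, Finset.sum_range_zero, mul_pow, Complex.I_sq,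
      Complex.I_pow_three, Nat.factorial]
    push_cast
    ring
  rw [h1] at h
  refine h.trans ?_
  have h4 : |a| ^ 4 = a ^ 4 := by rw [← abs_pow, abs_of_nonneg (by positivity)]
  rw [h4]
  refine mul_le_of_le_one_right (by positivity) ?_
  norm_num [Nat.factorial]

section CharacteristicFunction

variable {ι : Type*} {V : Finset ι} {w a : ι → ℝ} {t : ℝ}

theorem norm_sum_exp_sub_cubic_le (hw : ∀ v ∈ V, 0 ≤ w v) (hw1 : ∑ v ∈ V, w v = 1)
    (ha0 : ∑ v ∈ V, w v * a v = 0) (hat : ∀ v ∈ V, |a v| ≤ t) (ht1 : t ≤ 1) :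
    ‖(∑ v ∈ V, (w v : ℂ) * Complex.exp (a v * Complex.I)) -
      (1 - ((∑ v ∈ V, w v * a v ^ 2 : ℝ) : ℂ) / 2 -
        ((∑ v ∈ V, w v * a v ^ 3 : ℝ) : ℂ) / 6 * Complex.I)‖ ≤ t ^ 4 := by
  have hw1' : ∑ v ∈ V, (w v : ℂ) = 1 := by exact_mod_cast hw1
  have ha0' : ∑ v ∈ V, (w v : ℂ) * a v = 0 := by exact_mod_cast ha0
  have h1 : (∑ v ∈ V, (w v : ℂ) * Complex.exp (a v * Complex.I)) -
      (1 - ((∑ v ∈ V, w v * a v ^ 2 : ℝ) : ℂ) / 2 -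
        ((∑ v ∈ V, w v * a v ^ 3 : ℝ) : ℂ) / 6 * Complex.I) =
      ∑ v ∈ V, (w v : ℂ) * (Complex.exp (a v * Complex.I) -
        (1 + a v * Complex.I - a v ^ 2 / 2 - a v ^ 3 / 6 * Complex.I)) := by
    simp only [mul_sub, mul_add, Finset.sum_sub_distrib, Finset.sum_add_distrib, mul_one, hw1',
      ← mul_assoc, ← Finset.sum_mul, ha0', ← mul_div_assoc, ← Finset.sum_div]
    push_cast
    ring
  rw [h1]
  refine (norm_sum_le _ _).trans ?_
  calc ∑ v ∈ V, ‖(w v : ℂ) * (Complex.exp (a v * Complex.I) -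
        (1 + a v * Complex.I - a v ^ 2 / 2 - a v ^ 3 / 6 * Complex.I))‖
      ≤ ∑ v ∈ V, w v * t ^ 4 := by
        refine Finset.sum_le_sum fun v hv => ?_
        rw [norm_mul, Complex.norm_real, Real.norm_of_nonneg (hw v hv)]
        refine mul_le_mul_of_nonneg_left ?_ (hw v hv)
        refine (norm_exp_sub_cubic_le ((hat v hv).trans ht1)).trans ?_
        rw [← abs_of_nonneg (show 0 ≤ a v ^ 4 by positivity), abs_pow]
        exact pow_le_pow_left₀ (abs_nonneg _) (hat v hv) 4
    _ = t ^ 4 := by rw [← Finset.sum_mul, hw1, one_mul]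

theorem sum_sum_mul_sub_sq (hw1 : ∑ v ∈ V, w v = 1) :
    ∑ v ∈ V, ∑ v' ∈ V, w v * w v' * (a v - a v') ^ 2 =
      2 * (∑ v ∈ V, w v * a v ^ 2 - (∑ v ∈ V, w v * a v) ^ 2) := by
  have h1 : ∀ v v', w v * w v' * (a v - a v') ^ 2 =
      (w v * a v ^ 2) * w v' + w v * (w v' * a v' ^ 2) - 2 * ((w v * a v) * (w v' * a v')) :=
    fun _ _ => by ring
  simp only [h1, Finset.sum_sub_distrib, Finset.sum_add_distrib, ← Finset.mul_sum,
    ← Finset.sum_mul, hw1]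
  ring

/-- The squared modulus is the double sum of `w w' cos (a - a')`. Since `|a - a'| ≤ 2 < π`, the
cosine is at most `1 - (2/π²)(a - a')²`, and `2/π² ≥ 1/5`; centring turns the double sum of squares
into twice the variance. -/
theorem norm_sum_exp_le (hw : ∀ v ∈ V, 0 ≤ w v) (hw1 : ∑ v ∈ V, w v = 1)
    (ha0 : ∑ v ∈ V, w v * a v = 0) (ha1 : ∀ v ∈ V, |a v| ≤ 1) :
    ‖∑ v ∈ V, (w v : ℂ) * Complex.exp (a v * Complex.I)‖ ≤
      Real.exp (-(∑ v ∈ V, w v * a v ^ 2) / 5) := by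
  set B := ∑ v ∈ V, w v * a v ^ 2 with hB
  have hB0 : 0 ≤ B := Finset.sum_nonneg fun v hv => mul_nonneg (hw v hv) (sq_nonneg _)
  refine le_of_sq_le_sq ?_ (Real.exp_pos _).le
  rw [Complex.sq_norm, Complex.normSq_apply, Complex.re_sum, Complex.im_sum]
  simp only [Complex.re_ofReal_mul, Complex.im_ofReal_mul, Complex.exp_ofReal_mul_I_re,
    Complex.exp_ofReal_mul_I_im, Finset.sum_mul_sum, ← Finset.sum_add_distrib]
  have h1 : ∀ v ∈ V, ∀ v' ∈ V, w v * Real.cos (a v) * (w v' * Real.cos (a v')) +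
      w v * Real.sin (a v) * (w v' * Real.sin (a v')) ≤
      w v * w v' - 1 / 5 * (w v * w v' * (a v - a v') ^ 2) := by
    intro v hv v' hv'
    have h2 : |a v - a v'| ≤ Real.pi := by
      have := abs_sub (a v) (a v')
      linarith [ha1 v hv, ha1 v' hv', Real.pi_gt_three]
    have h3 := Real.cos_le_one_sub_mul_cos_sq h2
    have h4 : 1 / 5 ≤ 2 / Real.pi ^ 2 := by
      rw [div_le_div_iff₀ (by norm_num) (by positivity)]
      nlinarith [Real.pi_lt_d2, Real.pi_pos]
    have h5 : Real.cos (a v - a v') ≤ 1 - 1 / 5 * (a v - a v') ^ 2 := by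
      nlinarith [sq_nonneg (a v - a v')]
    rw [Real.cos_sub] at h5
    nlinarith [mul_le_mul_of_nonneg_left h5 (mul_nonneg (hw v hv) (hw v' hv'))]
  calc _ ≤ ∑ v ∈ V, ∑ v' ∈ V, (w v * w v' - 1 / 5 * (w v * w v' * (a v - a v') ^ 2)) :=
        Finset.sum_le_sum fun v hv => Finset.sum_le_sum fun v' hv' => h1 v hv v' hv'
    _ = 1 - 2 / 5 * B := by
        simp only [Finset.sum_sub_distrib, ← Finset.mul_sum]
        rw [sum_sum_mul_sub_sq hw1, ha0]
        simp only [hw1, mul_one]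
        ring
    _ ≤ Real.exp (-(2 / 5 * B)) := by linarith [Real.add_one_le_exp (-(2 / 5 * B))]
    _ = _ := by rw [← Real.exp_nat_mul]; congr 1; push_cast; ring

/-- Powers of a centred characteristic function are close to a Gaussian, with an error of
relative order `n t⁴ + n² t⁶`; taking real parts removes the cubic term. -/
theorem abs_re_pow_sub_exp_le (hw : ∀ v ∈ V, 0 ≤ w v) (hw1 : ∑ v ∈ V, w v = 1)
    (ha0 : ∑ v ∈ V, w v * a v = 0) (hat : ∀ v ∈ V, |a v| ≤ t) (ht0 : 0 ≤ t) (ht1 : t ≤ 1)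
    {n : ℕ} (hn : 1 ≤ n) :
    |((∑ v ∈ V, (w v : ℂ) * Complex.exp (a v * Complex.I)) ^ n).re -
        Real.exp (-(n * ∑ v ∈ V, w v * a v ^ 2) / 2)| ≤
      (6 * n * t ^ 4 + n ^ 2 * t ^ 6) * Real.exp (-(n * ∑ v ∈ V, w v * a v ^ 2) / 5) := by
  set f := ∑ v ∈ V, (w v : ℂ) * Complex.exp (a v * Complex.I)
  have hf1 := norm_sum_exp_sub_cubic_le hw hw1 ha0 hat ht1
  have hf2 := norm_sum_exp_le hw hw1 ha0 fun v hv => (hat v hv).trans ht1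
  set B := ∑ v ∈ V, w v * a v ^ 2 with hB
  set T := ∑ v ∈ V, w v * a v ^ 3 with hT
  have hB0 : 0 ≤ B := Finset.sum_nonneg fun v hv => mul_nonneg (hw v hv) (sq_nonneg _)
  have hBt : B ≤ t ^ 2 := by
    calc B ≤ ∑ v ∈ V, w v * t ^ 2 := Finset.sum_le_sum fun v hv =>
          mul_le_mul_of_nonneg_left (sq_le_sq' (by linarith [(abs_le.mp (hat v hv)).1])
            (abs_le.mp (hat v hv)).2) (hw v hv)
      _ = t ^ 2 := by rw [← Finset.sum_mul, hw1, one_mul]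
  have hTt : |T| ≤ t ^ 3 := by
    calc |T| ≤ ∑ v ∈ V, |w v * a v ^ 3| := Finset.abs_sum_le_sum_abs _ _
      _ ≤ ∑ v ∈ V, w v * t ^ 3 := Finset.sum_le_sum fun v hv => by
          rw [abs_mul, abs_of_nonneg (hw v hv), abs_pow]
          exact mul_le_mul_of_nonneg_left (pow_le_pow_left₀ (abs_nonneg _) (hat v hv) 3) (hw v hv)
      _ = t ^ 3 := by rw [← Finset.sum_mul, hw1, one_mul]
  have ht2 : t ^ 2 ≤ 1 := pow_le_one₀ ht0 ht1
  have ht3 : t ^ 3 ≤ t ^ 2 := pow_le_pow_of_le_one ht0 ht1 (by norm_num)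
  -- The Taylor polynomial of the characteristic function is `1 + z`, and `‖z‖² ≤ t⁴`, so `exp z`
  -- approximates it to order `t⁴`.
  set z : ℂ := -(B / 2 : ℂ) - T / 6 * Complex.I with hz
  have hznorm : ‖z‖ ≤ t ^ 2 := by
    calc ‖z‖ ≤ ‖-(B / 2 : ℂ)‖ + ‖(T / 6 * Complex.I : ℂ)‖ := norm_sub_le _ _
      _ = B / 2 + |T| / 6 := by
        rw [norm_neg, norm_mul, Complex.norm_I, mul_one, norm_div, norm_div, Complex.norm_real,
          Complex.norm_real, Real.norm_of_nonneg hB0, Real.norm_eq_abs]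
        norm_num
      _ ≤ t ^ 2 := by linarith
  have hfb : ‖f - Complex.exp z‖ ≤ 2 * t ^ 4 := by
    have h1 := Complex.norm_exp_sub_one_sub_id_le (hznorm.trans ht2)
    have h2 : ‖z‖ ^ 2 ≤ t ^ 4 := by
      calc ‖z‖ ^ 2 ≤ (t ^ 2) ^ 2 := pow_le_pow_left₀ (norm_nonneg _) hznorm 2
        _ = t ^ 4 := by ring
    have h3 : f - Complex.exp z = (f - (1 - (B : ℂ) / 2 - (T : ℂ) / 6 * Complex.I)) -
        (Complex.exp z - 1 - z) := by rw [hz]; ring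
    rw [h3]
    exact (norm_sub_le _ _).trans (by linarith)
  have hbnorm : ‖Complex.exp z‖ ≤ Real.exp (-B / 5) := by
    rw [Complex.norm_exp]
    refine Real.exp_le_exp.mpr ?_
    have : z.re = -B / 2 := by simp [hz, neg_div]
    rw [this]; linarith
  obtain ⟨m, rfl⟩ : ∃ m, n = m + 1 := ⟨n - 1, by omega⟩
  have hpow : ‖f ^ (m + 1) - Complex.exp z ^ (m + 1)‖ ≤
      6 * (m + 1) * t ^ 4 * Real.exp (-((m + 1 : ℕ) * B) / 5) := by
    refine (norm_pow_sub_pow_le_mul hf2 hbnorm m).trans ?_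
    -- Telescoping leaves only `n - 1` decay factors; restoring the missing one costs at most `e ≤
    -- 3`.
    have h1 : Real.exp (-B / 5) ^ m ≤ 3 * Real.exp (-((m + 1 : ℕ) * B) / 5) := by
      have h2 : Real.exp (-B / 5) ^ m =
          Real.exp (B / 5) * Real.exp (-((m + 1 : ℕ) * B) / 5) := by
        rw [← Real.exp_nat_mul, ← Real.exp_add]; congr 1; push_cast; ring
      rw [h2]
      refine mul_le_mul_of_nonneg_right ?_ (Real.exp_pos _).le
      calc Real.exp (B / 5) ≤ Real.exp 1 := Real.exp_le_exp.mpr (by linarith)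
        _ ≤ 3 := by linarith [Real.exp_one_lt_d9]
    calc (m + 1) * Real.exp (-B / 5) ^ m * ‖f - Complex.exp z‖
        ≤ (m + 1) * (3 * Real.exp (-((m + 1 : ℕ) * B) / 5)) * (2 * t ^ 4) := by gcongr
      _ = _ := by ring
  have hbn : Complex.exp z ^ (m + 1) = Real.exp (-((m + 1 : ℕ) * B) / 2) *
      Complex.exp (((-((m + 1 : ℕ) * T / 6) : ℝ) : ℂ) * Complex.I) := by
    rw [← Complex.exp_nat_mul, Complex.ofReal_exp, ← Complex.exp_add]
    congr 1
    rw [hz]; push_cast; ring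
  -- The cubic term enters `exp z` only as a phase `y` of size `n t³`. The real part sees `cos y -
  -- 1`, which is of order `y²`.
  have hre : |(Complex.exp z ^ (m + 1)).re - Real.exp (-((m + 1 : ℕ) * B) / 2)| ≤
      ((m + 1 : ℕ) : ℝ) ^ 2 * t ^ 6 * Real.exp (-((m + 1 : ℕ) * B) / 5) := by
    rw [hbn, Complex.re_ofReal_mul, Complex.exp_ofReal_mul_I_re, Real.cos_neg]
    set E := Real.exp (-((m + 1 : ℕ) * B) / 2) with hE
    set y := ((m + 1 : ℕ) : ℝ) * T / 6 with hy
    have h1 : |Real.cos y - 1| ≤ y ^ 2 := by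
      rw [abs_le]
      constructor
      · nlinarith [Real.one_sub_sq_div_two_le_cos (x := y), sq_nonneg y]
      · linarith [Real.cos_le_one y, sq_nonneg y]
    have h2 : y ^ 2 ≤ ((m + 1 : ℕ) : ℝ) ^ 2 * t ^ 6 := by
      have h3 : T ^ 2 ≤ t ^ 6 := by
        rw [← sq_abs T]
        calc |T| ^ 2 ≤ (t ^ 3) ^ 2 := pow_le_pow_left₀ (abs_nonneg _) hTt 2
          _ = t ^ 6 := by ring
      calc y ^ 2 = ((m + 1 : ℕ) : ℝ) ^ 2 * (T ^ 2 / 36) := by rw [hy]; ring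
        _ ≤ ((m + 1 : ℕ) : ℝ) ^ 2 * t ^ 6 := by gcongr; linarith [sq_nonneg T]
    have h4 : E ≤ Real.exp (-((m + 1 : ℕ) * B) / 5) := Real.exp_le_exp.mpr (by
      have : 0 ≤ ((m + 1 : ℕ) : ℝ) * B := by positivity
      linarith)
    calc |E * Real.cos y - E| = |Real.cos y - 1| * E := by
          rw [← mul_sub_one, abs_mul, abs_of_pos (Real.exp_pos _), mul_comm]
      _ ≤ (((m + 1 : ℕ) : ℝ) ^ 2 * t ^ 6) * Real.exp (-((m + 1 : ℕ) * B) / 5) :=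
          mul_le_mul (h1.trans h2) h4 (Real.exp_pos _).le (by positivity)
  have hre2 : |(f ^ (m + 1)).re - (Complex.exp z ^ (m + 1)).re| ≤
      6 * (m + 1) * t ^ 4 * Real.exp (-((m + 1 : ℕ) * B) / 5) := by
    rw [← Complex.sub_re]
    exact (Complex.abs_re_le_norm _).trans hpow
  refine (abs_sub_le _ (Complex.exp z ^ (m + 1)).re _).trans ((add_le_add hre2 hre).trans ?_)
  push_cast
  apply le_of_eq
  ring

end CharacteristicFunction

end LatticeWalk

/-! ### Gaussian integrals, and covariance bounds uniform in the weights. -/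

namespace LatticeWalk

open MeasureTheory

variable {d : ℕ}

section Gaussian

open Matrix
open scoped MatrixOrder

theorem integral_exp_neg_dotProduct_self :
    ∫ y : Fin d → ℝ, Real.exp (-(y ⬝ᵥ y) / 2) = (2 * Real.pi) ^ ((d : ℝ) / 2) := by
  have h1 : ∀ y : Fin d → ℝ, Real.exp (-(y ⬝ᵥ y) / 2) = ∏ i, Real.exp (-(1 / 2) * y i ^ 2) := by
    intro y
    rw [← Real.exp_sum]
    congr 1
    rw [← Finset.mul_sum, dotProduct]
    simp only [← sq]
    ring
  simp_rw [h1]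
  rw [integral_fintype_prod_volume_eq_pow fun t : ℝ => Real.exp (-(1 / 2) * t ^ 2),
    integral_gaussian, Fintype.card_fin, Real.sqrt_eq_rpow, ← Real.rpow_natCast,
    ← Real.rpow_mul (by positivity)]
  congr 1 <;> ring

/-- The Gaussian integral of a positive definite quadratic form. -/
theorem integral_exp_neg_quadratic {A : Matrix (Fin d) (Fin d) ℝ} (hA : A.PosDef) :
    ∫ y : Fin d → ℝ, Real.exp (-(y ⬝ᵥ A *ᵥ y) / 2) =
      (2 * Real.pi) ^ ((d : ℝ) / 2) * A.det ^ (-(1 : ℝ) / 2) := by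
  -- Substituting the positive square root turns the form into `y ⬝ᵥ y`, with Jacobian `|det S| =
  -- (det A)^{1/2}`.
  set S := CFC.sqrt A with hS
  have hSS : S * S = A := CFC.sqrt_mul_sqrt_self A (nonneg_iff_posSemidef.mpr hA.posSemidef)
  have hSH : Sᵀ = S := by
    have := (nonneg_iff_posSemidef.mp (CFC.sqrt_nonneg A)).isHermitian
    simpa [IsHermitian] using this
  have hdet : S.det ^ 2 = A.det := by rw [sq, ← det_mul, hSS]
  have hdet0 : S.det ≠ 0 := fun h => by
    have := hA.det_pos
    rw [← hdet, h] at this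
    simp at this
  have h1 : ∀ y : Fin d → ℝ, y ⬝ᵥ A *ᵥ y = S.toLin' y ⬝ᵥ S.toLin' y := fun y => by
    rw [toLin'_apply, dotProduct_mulVec (S *ᵥ y), ← mulVec_transpose, hSH, mulVec_mulVec, hSS,
      dotProduct_comm]
  have hmeas : Measurable (S.toLin' : (Fin d → ℝ) → (Fin d → ℝ)) :=
    (LinearMap.continuous_of_finiteDimensional _).measurable
  have h2 := integral_map (μ := volume) hmeas.aemeasurable
    (f := fun y : Fin d → ℝ => Real.exp (-(y ⬝ᵥ y) / 2)) (by
      apply Continuous.aestronglyMeasurable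
      unfold dotProduct
      fun_prop)
  simp_rw [h1]
  rw [← h2, Real.map_matrix_volume_pi_eq_smul_volume_pi hdet0, integral_smul_measure,
    integral_exp_neg_dotProduct_self, ENNReal.toReal_ofReal (abs_nonneg _), smul_eq_mul, mul_comm]
  congr 1
  rw [neg_div, Real.rpow_neg hA.det_pos.le, ← Real.sqrt_eq_rpow, ← hdet, Real.sqrt_sq_eq_abs,
    abs_inv]

end Gaussian

theorem exists_one_add_pow_mul_exp_le (N : ℕ) {c : ℝ} (hc : 0 < c) :
    ∃ A : ℝ, 0 ≤ A ∧ ∀ s : ℝ, 0 ≤ s → (1 + s) ^ N * Real.exp (-(c * s ^ 2)) ≤ A := by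
  -- Each factor `1 + s` is bounded by a multiple of `exp (a s²)`; the choice gives `N a ≤ c`.
  set a := c / (N + 1) with ha
  have ha0 : 0 < a := by positivity
  refine ⟨(1 + 1 / (4 * a)) ^ N, by positivity, fun s hs => ?_⟩
  have h1 : 1 + s ≤ (1 + 1 / (4 * a)) * Real.exp (a * s ^ 2) := by
    calc 1 + s ≤ (1 + 1 / (4 * a)) * (a * s ^ 2 + 1) := by
          have h2 : s ≤ a * s ^ 2 + 1 / (4 * a) := by
            have : a * s ^ 2 + 1 / (4 * a) - s = (2 * a * s - 1) ^ 2 / (4 * a) := by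
              field_simp; ring
            have h3 : 0 ≤ (2 * a * s - 1) ^ 2 / (4 * a) := by positivity
            linarith
          have h4 : 0 ≤ 1 / (4 * a) * (a * s ^ 2) := by positivity
          linarith
      _ ≤ _ := by gcongr; exact Real.add_one_le_exp _
  calc (1 + s) ^ N * Real.exp (-(c * s ^ 2))
      ≤ ((1 + 1 / (4 * a)) * Real.exp (a * s ^ 2)) ^ N * Real.exp (-(c * s ^ 2)) := by gcongr
    _ = (1 + 1 / (4 * a)) ^ N * Real.exp (N * (a * s ^ 2) - c * s ^ 2) := by
        rw [mul_pow, ← Real.exp_nat_mul, mul_assoc, ← Real.exp_add]; rfl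
    _ ≤ (1 + 1 / (4 * a)) ^ N * 1 := by
        gcongr
        rw [Real.exp_le_one_iff, sub_nonpos]
        have : N * a ≤ c := by
          rw [ha, mul_div_assoc', div_le_iff₀ (by positivity)]; nlinarith
        nlinarith [sq_nonneg s]
    _ = _ := mul_one _

/-- The coordinates of the mean step. -/
noncomputable def mean (W : LatticeWalk d) (i : Fin d) : ℝ :=
  ∑ v ∈ W.step.support, W.step v * v i

/-- The linear functional `⟨y, ·⟩` of the centred step. -/
noncomputable def dev (W : LatticeWalk d) (y : Fin d → ℝ) (v : Fin d → ℤ) : ℝ :=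
  ∑ i, y i * (v i - W.mean i)

/-- The covariance matrix of the step distribution. -/
noncomputable def cov (W : LatticeWalk d) : Matrix (Fin d) (Fin d) ℝ :=
  Matrix.of fun i j => (∑ v ∈ W.step.support, W.step v * (v i * v j)) - W.mean i * W.mean j

theorem dev_eq (W : LatticeWalk d) (y : Fin d → ℝ) (v : Fin d → ℤ) :
    W.dev y v = ∑ i, y i * (v i : ℝ) - ∑ i, y i * W.mean i := by
  simp [dev, mul_sub]

theorem sum_step_mul_dev (W : LatticeWalk d) (y : Fin d → ℝ) :
    ∑ v ∈ W.step.support, W.step v * W.dev y v = 0 := by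
  simp only [dev_eq, mul_sub, Finset.sum_sub_distrib]
  rw [← Finset.sum_mul, W.sum_step, one_mul, sub_eq_zero]
  simp only [mean, Finset.mul_sum]
  rw [Finset.sum_comm]
  exact Finset.sum_congr rfl fun i _ => Finset.sum_congr rfl fun v _ => by ring

theorem dev_smul (W : LatticeWalk d) (c : ℝ) (y : Fin d → ℝ) (v : Fin d → ℤ) :
    W.dev (c • y) v = c * W.dev y v := by
  simp [dev, Finset.mul_sum, mul_assoc]

theorem continuous_dev (W : LatticeWalk d) (v : Fin d → ℤ) : Continuous fun y => W.dev y v := by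
  unfold dev; fun_prop

theorem cov_apply (W : LatticeWalk d) (i j : Fin d) :
    W.cov i j = ∑ v ∈ W.step.support, W.step v * ((v i - W.mean i) * (v j - W.mean j)) := by
  have h : ∀ v : Fin d → ℤ, W.step v * (((v i : ℝ) - W.mean i) * (v j - W.mean j)) =
      W.step v * (v i * v j) - W.mean j * (W.step v * v i) - W.mean i * (W.step v * v j)
        + W.mean i * W.mean j * W.step v := fun v => by ring
  simp only [h, Finset.sum_add_distrib, Finset.sum_sub_distrib, ← Finset.mul_sum, W.sum_step]
  simp only [cov, Matrix.of_apply, mean]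
  ring

open Matrix in
theorem dotProduct_cov_mulVec (W : LatticeWalk d) (y : Fin d → ℝ) :
    y ⬝ᵥ W.cov *ᵥ y = ∑ v ∈ W.step.support, W.step v * W.dev y v ^ 2 := by
  simp only [dotProduct, mulVec, cov_apply, Finset.mul_sum, Finset.sum_mul, dev, sq]
  conv_lhs => enter [2, i]; rw [Finset.sum_comm]
  rw [Finset.sum_comm]
  refine Finset.sum_congr rfl fun v _ => ?_
  refine Finset.sum_congr rfl fun i _ => Finset.sum_congr rfl fun j _ => by ring

theorem exists_abs_dev_le (V : Finset (Fin d → ℤ)) :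
    ∃ K : ℝ, 0 < K ∧ ∀ W : LatticeWalk d, W.step.support = V → ∀ v ∈ V, ∀ y : Fin d → ℝ,
      |W.dev y v| ≤ K * ‖y‖ := by
  set L : ℝ := ∑ v ∈ V, ∑ i, |(v i : ℝ)| with hL
  have hL0 : 0 ≤ L := by positivity
  have hv : ∀ v ∈ V, ∀ i, |(v i : ℝ)| ≤ L := fun v hv i =>
    (Finset.single_le_sum (f := fun i => |(v i : ℝ)|) (fun _ _ => abs_nonneg _)
      (Finset.mem_univ i)).trans
      (Finset.single_le_sum (f := fun v : Fin d → ℤ => ∑ i, |(v i : ℝ)|)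
        (fun _ _ => by positivity) hv)
  refine ⟨d * (2 * L) + 1, by positivity, fun W hW v hvV y => ?_⟩
  have hm : ∀ i, |W.mean i| ≤ L := fun i => by
    calc |W.mean i| ≤ ∑ v ∈ W.step.support, |W.step v * v i| := Finset.abs_sum_le_sum_abs _ _
      _ ≤ ∑ v ∈ W.step.support, W.step v * L := Finset.sum_le_sum fun v hv' => by
          rw [abs_mul, abs_of_nonneg (W.step_nonneg v)]
          exact mul_le_mul_of_nonneg_left (hv v (hW ▸ hv') i) (W.step_nonneg v)
      _ = L := by rw [← Finset.sum_mul, W.sum_step, one_mul]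
  calc |W.dev y v| ≤ ∑ i, |y i * (v i - W.mean i)| := Finset.abs_sum_le_sum_abs _ _
    _ ≤ ∑ _i : Fin d, ‖y‖ * (2 * L) := Finset.sum_le_sum fun i _ => by
        rw [abs_mul]
        refine mul_le_mul (norm_le_pi_norm y i) ?_ (abs_nonneg _) (norm_nonneg _)
        exact (abs_sub _ _).trans (by linarith [hv v hvV i, hm i])
    _ = d * (2 * L) * ‖y‖ := by simp; ring
    _ ≤ _ := by nlinarith [norm_nonneg y]

/-- The variances of the linear functionals of the step are uniformly bounded below. -/
theorem exists_le_sum_dev_sq (W : LatticeWalk d) (hW : W.Irred) {q : ℝ} (hq : 0 < q) :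
    ∃ c : ℝ, 0 < c ∧ ∀ W' : LatticeWalk d, W'.step.support = W.step.support →
      (∀ v ∈ W.step.support, q ≤ W'.step v) → ∀ y : Fin d → ℝ,
        c * ‖y‖ ^ 2 ≤ ∑ v ∈ W'.step.support, W'.step v * W'.dev y v ^ 2 := by
  set V := W.step.support with hV
  -- `G` depends only on the support and is homogeneous of degree two. A zero on the unit sphere
  -- would be a nonzero functional constant on the steps. The variance, half a weighted double sum,
  -- is at least `q² G / 2`.
  set G : (Fin d → ℝ) → ℝ := fun y => ∑ v ∈ V, ∑ v' ∈ V, (∑ i, y i * (v i - v' i : ℝ)) ^ 2 with hG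
  have hGc : Continuous G := by fun_prop
  have hG0 : ∀ y, 0 ≤ G y := fun y => by positivity
  obtain ⟨δ, hδ0, hδ⟩ := (isCompact_sphere (0 : Fin d → ℝ) 1).exists_forall_le' (a := 0)
    hGc.continuousOn fun y hy => by
      refine (hG0 y).lt_of_ne' fun h0 => ?_
      obtain ⟨v₀, hv₀⟩ := W.support_nonempty
      have h1 : y = 0 := by
        refine W.eq_zero_of_constant_on_support hW y (∑ i, y i * (v₀ i : ℝ)) fun v hv => ?_
        have h2 := (Finset.sum_eq_zero_iff_of_nonneg fun _ _ => by positivity).mp h0 v hv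
        have h3 := (Finset.sum_eq_zero_iff_of_nonneg fun _ _ => by positivity).mp h2 v₀ hv₀
        have h4 := pow_eq_zero_iff (two_ne_zero) |>.mp h3
        simp only [mul_sub, Finset.sum_sub_distrib] at h4
        linarith
      simp [h1] at hy
  refine ⟨q ^ 2 * δ / 2, by positivity, fun W' hsupp hq' y => ?_⟩
  have hGy : δ * ‖y‖ ^ 2 ≤ G y := by
    by_cases hy : y = 0
    · simp [hy, hG0]
    · have hn : 0 < ‖y‖ := norm_pos_iff.mpr hy
      have h1 := hδ (‖y‖⁻¹ • y) (by simp [norm_smul, hn.ne'])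
      have h2 : G (‖y‖⁻¹ • y) = (‖y‖ ^ 2)⁻¹ * G y := by
        simp only [hG, Finset.mul_sum, Pi.smul_apply, smul_eq_mul]
        refine Finset.sum_congr rfl fun v _ => Finset.sum_congr rfl fun v' _ => ?_
        simp only [mul_assoc, ← Finset.mul_sum, mul_pow, inv_pow]
      rw [h2, ← div_eq_inv_mul, le_div_iff₀ (by positivity)] at h1
      exact h1
  have hvar := sum_sum_mul_sub_sq (a := W'.dev y) W'.sum_step
  rw [sum_step_mul_dev, hsupp] at hvar
  rw [hsupp]
  have hlow : q ^ 2 * G y ≤ ∑ v ∈ V, ∑ v' ∈ V,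
      W'.step v * W'.step v' * (W'.dev y v - W'.dev y v') ^ 2 := by
    simp only [hG, Finset.mul_sum]
    refine Finset.sum_le_sum fun v hv => Finset.sum_le_sum fun v' hv' => ?_
    have h1 : W'.dev y v - W'.dev y v' = ∑ i, y i * (v i - v' i : ℝ) := by
      simp only [dev_eq, mul_sub, Finset.sum_sub_distrib]; ring
    rw [h1, sq q]
    exact mul_le_mul_of_nonneg_right (mul_le_mul (hq' v hv) (hq' v' hv') hq.le
      (W'.step_nonneg v)) (sq_nonneg _)
  nlinarith [mul_le_mul_of_nonneg_left hGy (sq_nonneg q)]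

theorem posDef_cov_of_le (W : LatticeWalk d) {c : ℝ} (hc : 0 < c)
    (h : ∀ y : Fin d → ℝ, c * ‖y‖ ^ 2 ≤ ∑ v ∈ W.step.support, W.step v * W.dev y v ^ 2) :
    W.cov.PosDef := by
  refine Matrix.PosDef.of_dotProduct_mulVec_pos ?_ fun y hy => ?_
  · ext i j
    simp [cov_apply, mul_comm]
  · have := norm_pos_iff.mpr hy
    rw [star_trivial, dotProduct_cov_mulVec]
    exact lt_of_lt_of_le (by positivity) (h y)

end LatticeWalk

/-! ### The uniform local limit theorem at the mean. -/

namespace LatticeWalk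

open MeasureTheory

variable {d : ℕ}

/-- The characteristic function of the centred step distribution, as a function on `ℝ^d`. -/
noncomputable def centredCharFn (W : LatticeWalk d) (y : Fin d → ℝ) : ℂ :=
  ∑ v ∈ W.step.support, (W.step v : ℂ) * Complex.exp (W.dev y v * Complex.I)

theorem continuous_centredCharFn (W : LatticeWalk d) : Continuous W.centredCharFn := by
  unfold centredCharFn
  have := W.continuous_dev
  fun_prop

/-- At `x = n · mean` the phase produced by centring the steps cancels the character of `-x`
exactly. -/
theorem charFn_pow_mul_chi (W : LatticeWalk d) {n : ℕ} {x : Fin d → ℤ}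
    (hx : ∀ i, (x i : ℝ) = n * W.mean i) (ω : Fin d → ℝ) :
    W.charFn (fun i => (ω i : UnitAddCircle)) ^ n * chi (-x) (fun i => (ω i : UnitAddCircle)) =
      W.centredCharFn ((2 * Real.pi) • ω) ^ n := by
  set s : ℂ := Complex.exp (2 * Real.pi * (∑ i, ω i * W.mean i : ℝ) * Complex.I) with hs
  have h1 : W.charFn (fun i => (ω i : UnitAddCircle)) =
      W.centredCharFn ((2 * Real.pi) • ω) * s := by
    rw [charFn, centredCharFn, Finset.sum_mul]
    refine Finset.sum_congr rfl fun v _ => ?_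
    rw [chi_mk, mul_assoc (W.step v : ℂ), hs, ← Complex.exp_add, dev_smul, dev_eq]
    congr 2
    push_cast
    ring
  have h2 : s ^ n * chi (-x) (fun i => (ω i : UnitAddCircle)) = 1 := by
    rw [chi_mk, hs, ← Complex.exp_nat_mul, ← Complex.exp_add, Complex.exp_eq_one_iff]
    refine ⟨0, ?_⟩
    have h3 : ∑ i, ω i * ((-x) i : ℝ) = -(n * ∑ i, ω i * W.mean i) := by
      simp only [Pi.neg_apply, Int.cast_neg, hx, Finset.mul_sum, ← Finset.sum_neg_distrib]
      exact Finset.sum_congr rfl fun i _ => by ring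
    rw [h3]
    push_cast
    ring
  rw [h1, mul_pow, mul_assoc, h2, mul_one]

theorem setIntegral_ball_comp_smul (W : LatticeWalk d) {n : ℕ} (hn : 1 ≤ n) (η : ℝ) :
    ∫ ω : Fin d → ℝ in Metric.ball 0 η, W.centredCharFn ((2 * Real.pi) • ω) ^ n =
      (((2 * Real.pi * √n) ^ d)⁻¹ : ℝ) •
        ∫ y : Fin d → ℝ in Metric.ball 0 (2 * Real.pi * √n * η),
          W.centredCharFn ((√n)⁻¹ • y) ^ n := by
  have hn' : 0 < √(n : ℝ) := Real.sqrt_pos.mpr (by exact_mod_cast hn)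
  have hR : 0 < 2 * Real.pi * √n := by positivity
  have h := Measure.setIntegral_comp_smul_of_pos (volume : Measure (Fin d → ℝ))
    (fun y => W.centredCharFn ((√n)⁻¹ • y) ^ n) (Metric.ball 0 η) hR
  rw [smul_ball hR.ne', smul_zero, Real.norm_of_nonneg hR.le, Module.finrank_fin_fun] at h
  rw [← h]
  congr 1
  ext ω
  rw [smul_smul]
  congr 3
  field_simp

/-- Inside the ball, `t = K‖y‖/√n` makes both `n t⁴` and `n² t⁶` of order `1/n`. Outside, `‖y‖ ≥ √n
η` gives `1 ≤ ‖y‖²/(n η²)`, which puts the Gaussian tail into the same form. -/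
theorem abs_indicator_sub_exp_le (W : LatticeWalk d) {K c η : ℝ} (hK : 0 < K) (hη : 0 < η)
    (hKη : 2 * Real.pi * K * η ≤ 1)
    (hdev : ∀ v ∈ W.step.support, ∀ y : Fin d → ℝ, |W.dev y v| ≤ K * ‖y‖)
    (hc : ∀ y : Fin d → ℝ, c * ‖y‖ ^ 2 ≤ ∑ v ∈ W.step.support, W.step v * W.dev y v ^ 2)
    (hc0 : 0 < c)
    {n : ℕ} (hn : 1 ≤ n) (y : Fin d → ℝ) :
    |(Metric.ball 0 (2 * Real.pi * √n * η)).indicator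
        (fun y => (W.centredCharFn ((√n)⁻¹ • y) ^ n).re) y -
      Real.exp (-(∑ v ∈ W.step.support, W.step v * W.dev y v ^ 2) / 2)| ≤
    (n : ℝ)⁻¹ * ((6 * K ^ 4 + K ^ 6 + (η ^ 2)⁻¹) *
      ((1 + ‖y‖) ^ 6 * Real.exp (-(c / 5 * ‖y‖ ^ 2)))) := by
  have hn0 : (0 : ℝ) < n := by exact_mod_cast hn
  have hn' : 0 < √(n : ℝ) := Real.sqrt_pos.mpr hn0
  have hsq : √(n : ℝ) ^ 2 = n := Real.sq_sqrt hn0.le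
  set Q := ∑ v ∈ W.step.support, W.step v * W.dev y v ^ 2 with hQ
  have hy0 := norm_nonneg y
  have hp : ∀ k ≤ 6, ‖y‖ ^ k ≤ (1 + ‖y‖) ^ 6 := fun k hk =>
    (pow_le_pow_left₀ hy0 (by linarith) k).trans (pow_le_pow_right₀ (by linarith) hk)
  have hexp : Real.exp (-Q / 5) ≤ Real.exp (-(c / 5 * ‖y‖ ^ 2)) :=
    Real.exp_le_exp.mpr (by linarith [hc y])
  by_cases hy : y ∈ Metric.ball (0 : Fin d → ℝ) (2 * Real.pi * √n * η)
  · rw [Set.indicator_of_mem hy]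
    rw [Metric.mem_ball, dist_zero_right] at hy
    set t := K * ‖y‖ / √n with ht
    have ht1 : t ≤ 1 := by
      rw [ht, div_le_one hn']
      nlinarith [mul_le_mul_of_nonneg_left hy.le hK.le, mul_le_mul_of_nonneg_right hKη hn'.le]
    have hmain := abs_re_pow_sub_exp_le (V := W.step.support) (w := W.step)
      (a := W.dev ((√n)⁻¹ • y)) (t := t) (fun v _ => W.step_nonneg v) W.sum_step
      (W.sum_step_mul_dev _) (fun v hv => by
        refine (hdev v hv _).trans (le_of_eq ?_)
        rw [norm_smul, norm_inv, Real.norm_of_nonneg hn'.le, ht]; ring) (by positivity) ht1 hn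
    have hB : (n : ℝ) * ∑ v ∈ W.step.support, W.step v * W.dev ((√n)⁻¹ • y) v ^ 2 = Q := by
      rw [hQ, Finset.mul_sum]
      refine Finset.sum_congr rfl fun v _ => ?_
      rw [dev_smul, mul_pow, inv_pow, hsq]
      field_simp
    rw [hB] at hmain
    refine hmain.trans ?_
    have h4 : (n : ℝ) * t ^ 4 = (n : ℝ)⁻¹ * (K ^ 4 * ‖y‖ ^ 4) := by
      have : √(n : ℝ) ^ 4 = n ^ 2 := by rw [pow_mul _ 2 2, hsq]
      rw [ht, div_pow, this, mul_pow]; field_simp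
    have h6 : (n : ℝ) ^ 2 * t ^ 6 = (n : ℝ)⁻¹ * (K ^ 6 * ‖y‖ ^ 6) := by
      have : √(n : ℝ) ^ 6 = n ^ 3 := by rw [pow_mul _ 2 3, hsq]
      rw [ht, div_pow, this, mul_pow]; field_simp
    calc (6 * n * t ^ 4 + n ^ 2 * t ^ 6) * Real.exp (-Q / 5)
        = (n : ℝ)⁻¹ * ((6 * K ^ 4 * ‖y‖ ^ 4 + K ^ 6 * ‖y‖ ^ 6) * Real.exp (-Q / 5)) := by
          rw [h6, mul_assoc 6, h4]; ring
      _ ≤ (n : ℝ)⁻¹ * ((6 * K ^ 4 * (1 + ‖y‖) ^ 6 + K ^ 6 * (1 + ‖y‖) ^ 6 +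
            (η ^ 2)⁻¹ * (1 + ‖y‖) ^ 6) * Real.exp (-(c / 5 * ‖y‖ ^ 2))) := by
          have h0 : 0 ≤ (η ^ 2)⁻¹ * (1 + ‖y‖) ^ 6 := by positivity
          have h1 := mul_le_mul_of_nonneg_left (hp 4 (by norm_num)) (show 0 ≤ 6 * K ^ 4 by positivity)
          have h2 := mul_le_mul_of_nonneg_left (hp 6 le_rfl) (show 0 ≤ K ^ 6 by positivity)
          refine mul_le_mul_of_nonneg_left (mul_le_mul ?_ hexp (Real.exp_pos _).le
            (by positivity)) (by positivity)
          linarith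
      _ = _ := by ring
  · rw [Set.indicator_of_notMem hy, zero_sub, abs_neg, abs_of_pos (Real.exp_pos _)]
    rw [Metric.mem_ball, dist_zero_right, not_lt] at hy
    have hQ0 : 0 ≤ Q := (by positivity : 0 ≤ c * ‖y‖ ^ 2).trans (hc y)
    have h1 : Real.exp (-Q / 2) ≤ Real.exp (-(c / 5 * ‖y‖ ^ 2)) :=
      (Real.exp_le_exp.mpr (by linarith)).trans hexp
    have h2 : 1 ≤ (n : ℝ)⁻¹ * ((η ^ 2)⁻¹ * ‖y‖ ^ 2) := by
      have h3 : √(n : ℝ) * η ≤ ‖y‖ := by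
        have : √(n : ℝ) * η * 1 ≤ √(n : ℝ) * η * (2 * Real.pi) :=
          mul_le_mul_of_nonneg_left (by linarith [Real.pi_gt_three]) (by positivity)
        linarith
      have h4 : (n : ℝ) * η ^ 2 ≤ ‖y‖ ^ 2 := by
        calc (n : ℝ) * η ^ 2 = (√n * η) ^ 2 := by rw [mul_pow, hsq]
          _ ≤ ‖y‖ ^ 2 := pow_le_pow_left₀ (by positivity) h3 2
      rw [← mul_assoc, ← mul_inv, ← div_eq_inv_mul, one_le_div (by positivity)]
      exact h4
    calc Real.exp (-Q / 2) ≤ 1 * Real.exp (-(c / 5 * ‖y‖ ^ 2)) := by rwa [one_mul]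
      _ ≤ ((n : ℝ)⁻¹ * ((η ^ 2)⁻¹ * ‖y‖ ^ 2)) * Real.exp (-(c / 5 * ‖y‖ ^ 2)) := by gcongr
      _ ≤ ((n : ℝ)⁻¹ * ((6 * K ^ 4 + K ^ 6 + (η ^ 2)⁻¹) * (1 + ‖y‖) ^ 6)) *
            Real.exp (-(c / 5 * ‖y‖ ^ 2)) := by
          gcongr
          · exact le_add_of_nonneg_left (by positivity)
          · exact hp 2 (by norm_num)
      _ = _ := by ring

/-- The contribution of a neighbourhood of the origin to the inversion formula, with constants
that are uniform over walks with comparable step distributions. -/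
theorem exists_abs_setIntegral_sub_le (d : ℕ) {K c η : ℝ} (hK : 0 < K) (hη : 0 < η)
    (hKη : 2 * Real.pi * K * η ≤ 1) (hc0 : 0 < c) :
    ∃ C : ℝ, 0 ≤ C ∧ ∀ W : LatticeWalk d,
      (∀ v ∈ W.step.support, ∀ y : Fin d → ℝ, |W.dev y v| ≤ K * ‖y‖) →
      (∀ y : Fin d → ℝ, c * ‖y‖ ^ 2 ≤ ∑ v ∈ W.step.support, W.step v * W.dev y v ^ 2) →
      ∀ n : ℕ, 1 ≤ n →
        |(∫ y : Fin d → ℝ in Metric.ball 0 (2 * Real.pi * √n * η),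
            W.centredCharFn ((√n)⁻¹ • y) ^ n).re -
          (2 * Real.pi) ^ ((d : ℝ) / 2) * W.cov.det ^ (-(1 : ℝ) / 2)| ≤ C * (n : ℝ)⁻¹ := by
  -- The `d + 1` extra powers leave the integrable weight `(1 + ‖y‖)^{-(d+1)}`.
  obtain ⟨A, hA0, hA⟩ := exists_one_add_pow_mul_exp_le (6 + (d + 1)) (c := c / 5) (by positivity)
  set C₀ := 6 * K ^ 4 + K ^ 6 + (η ^ 2)⁻¹ with hC₀
  have hJ : Integrable (fun y : Fin d → ℝ => (1 + ‖y‖) ^ (-((d : ℝ) + 1))) :=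
    integrable_one_add_norm (by simp)
  have hJ0 : ∀ y : Fin d → ℝ, 0 ≤ (1 + ‖y‖) ^ (-((d : ℝ) + 1)) := fun y => by positivity
  have hbound : ∀ y : Fin d → ℝ, (1 + ‖y‖) ^ 6 * Real.exp (-(c / 5 * ‖y‖ ^ 2)) ≤
      A * (1 + ‖y‖) ^ (-((d : ℝ) + 1)) := by
    intro y
    have h1 : (1 + ‖y‖) ^ (-((d : ℝ) + 1)) = ((1 + ‖y‖) ^ (d + 1))⁻¹ := by
      rw [Real.rpow_neg (by positivity)]
      norm_cast
    rw [h1, ← div_eq_mul_inv, le_div_iff₀ (by positivity)]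
    refine le_trans (le_of_eq ?_) (hA ‖y‖ (norm_nonneg y))
    rw [pow_add]; ring
  refine ⟨C₀ * A * ∫ y : Fin d → ℝ, (1 + ‖y‖) ^ (-((d : ℝ) + 1)), by positivity, ?_⟩
  intro W hdev hc n hn
  set g : (Fin d → ℝ) → ℂ := fun y => W.centredCharFn ((√n)⁻¹ • y) ^ n with hg
  have hgc : Continuous g := (W.continuous_centredCharFn.comp (continuous_const_smul _)).pow n
  set U := Metric.ball (0 : Fin d → ℝ) (2 * Real.pi * √n * η) with hU
  have hUm : MeasurableSet U := Metric.isOpen_ball.measurableSet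
  have hgU : IntegrableOn g U :=
    (hgc.continuousOn.integrableOn_compact (isCompact_closedBall 0 _)).mono_set
      Metric.ball_subset_closedBall
  have hre : (∫ y in U, g y).re = ∫ y, U.indicator (fun y => (g y).re) y := by
    rw [integral_indicator hUm]
    exact (integral_re hgU).symm
  have hEc : Continuous fun y : Fin d → ℝ =>
      Real.exp (-(∑ v ∈ W.step.support, W.step v * W.dev y v ^ 2) / 2) := by
    have := W.continuous_dev
    fun_prop
  have hE : Integrable fun y : Fin d → ℝ =>
      Real.exp (-(∑ v ∈ W.step.support, W.step v * W.dev y v ^ 2) / 2) := by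
    refine (hJ.const_mul A).mono' hEc.aestronglyMeasurable (Filter.Eventually.of_forall fun y => ?_)
    rw [Real.norm_of_nonneg (Real.exp_pos _).le]
    refine le_trans ?_ (hbound y)
    calc _ ≤ 1 * Real.exp (-(c / 5 * ‖y‖ ^ 2)) := by
          rw [one_mul]
          have : 0 ≤ c * ‖y‖ ^ 2 := by positivity
          exact Real.exp_le_exp.mpr (by linarith [hc y])
      _ ≤ _ := by gcongr; exact one_le_pow₀ (by linarith [norm_nonneg y])
  have hgauss := integral_exp_neg_quadratic (W.posDef_cov_of_le hc0 hc)
  simp_rw [dotProduct_cov_mulVec] at hgauss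
  have hgre : Integrable (U.indicator fun y => (g y).re) :=
    (integrable_indicator_iff hUm).mpr (Integrable.re hgU)
  rw [hre, ← hgauss, ← integral_sub hgre hE]
  have hfin := norm_integral_le_of_norm_le ((hJ.const_mul (C₀ * A)).const_mul (n : ℝ)⁻¹)
    (Filter.Eventually.of_forall fun y => by
      rw [Real.norm_eq_abs]
      refine (W.abs_indicator_sub_exp_le hK hη hKη hdev hc hc0 hn y).trans ?_
      rw [mul_assoc C₀]
      exact mul_le_mul_of_nonneg_left (mul_le_mul_of_nonneg_left (hbound y) (by positivity))
        (by positivity))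
  rw [Real.norm_eq_abs, integral_const_mul, integral_const_mul] at hfin
  exact hfin.trans_eq (mul_comm _ _)

theorem exists_pow_mul_pow_le (k : ℕ) {γ : ℝ} (h0 : 0 ≤ γ) (h1 : γ < 1) :
    ∃ C : ℝ, 0 ≤ C ∧ ∀ n : ℕ, (n : ℝ) ^ k * γ ^ n ≤ C := by
  obtain ⟨C, hC⟩ := (tendsto_pow_const_mul_const_pow_of_lt_one k h0 h1).bddAbove_range
  have hC' : ∀ n : ℕ, (n : ℝ) ^ k * γ ^ n ≤ C := fun n => hC ⟨n, rfl⟩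
  exact ⟨C, (by positivity : (0 : ℝ) ≤ ((0 : ℕ) : ℝ) ^ k * γ ^ 0).trans (hC' 0), hC'⟩

/-- A local central limit theorem at the mean with error `O(1/n)`, uniform over all walks with a
given set of steps and step probabilities bounded below. -/
theorem exists_abs_prob_mul_sub_le (W : LatticeWalk d) (hW : W.Irred) {q : ℝ} (hq : 0 < q) :
    ∃ C : ℝ, 0 ≤ C ∧ ∀ W' : LatticeWalk d,
      W'.step.support = W.step.support → (∀ v ∈ W.step.support, q ≤ W'.step v) →
      ∀ m n x, 1 ≤ n → 0 < W.prob m x → n ≡ m [MOD W.period] →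
        (∀ i, (x i : ℝ) = n * W'.mean i) →
        |(2 * Real.pi * n) ^ ((d : ℝ) / 2) * W'.prob n x -
          W.period * W'.cov.det ^ (-(1 : ℝ) / 2)| ≤ C * (n : ℝ)⁻¹ := by
  obtain ⟨K, hK, hdev⟩ := exists_abs_dev_le W.step.support
  obtain ⟨c, hc0, hc⟩ := W.exists_le_sum_dev_sq hW hq
  -- The radius `1/(2πK)` keeps all centred phases at most one on the ball, as the Taylor estimates
  -- require.
  obtain ⟨η, hη0, hηρ, γ, hγ0, hγ1, hper⟩ := W.exists_norm_prob_sub_period_mul_le hW hq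
    (ρ := 1 / (2 * Real.pi * K)) (by positivity)
  have hKη : 2 * Real.pi * K * η ≤ 1 := by
    rw [le_div_iff₀ (by positivity)] at hηρ
    linarith
  obtain ⟨C₁, hC₁, hloc⟩ := exists_abs_setIntegral_sub_le d hK hη0 hKη hc0
  obtain ⟨C₂, hC₂, hexp⟩ := exists_pow_mul_pow_le (d + 1) hγ0 hγ1
  refine ⟨W.period * ((2 * Real.pi) ^ (-((d : ℝ) / 2)) * C₁) +
    (2 * Real.pi) ^ ((d : ℝ) / 2) * C₂, by positivity, ?_⟩
  intro W' hsupp hq' m n x hn hm hmod hx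
  have hn0 : (0 : ℝ) < n := by exact_mod_cast hn
  have hn1 : (1 : ℝ) ≤ n := by exact_mod_cast hn
  have h1 := hper W' hsupp hq' m n x hm hmod
  simp_rw [W'.charFn_pow_mul_chi hx] at h1
  rw [setIntegral_ball_comp_smul W' hn η] at h1
  have h2 := hloc W' (fun v hv y => hdev W' hsupp v (hsupp ▸ hv) y) (hc W' hsupp hq') n hn
  set J := ∫ y : Fin d → ℝ in Metric.ball 0 (2 * Real.pi * √n * η),
    W'.centredCharFn ((√n)⁻¹ • y) ^ n with hJ
  set D := W'.cov.det ^ (-(1 : ℝ) / 2) with hD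
  set P := (2 * Real.pi * n : ℝ) ^ ((d : ℝ) / 2) with hP
  have hP0 : 0 ≤ P := by positivity
  have h3 : |W'.prob n x - W.period * (((2 * Real.pi * √n) ^ d)⁻¹ * J.re)| ≤ γ ^ n := by
    refine le_trans (le_of_eq_of_le ?_ (Complex.abs_re_le_norm _)) h1
    rw [Complex.sub_re, Complex.ofReal_re, ← Complex.ofReal_natCast, Complex.re_ofReal_mul,
      Complex.real_smul, Complex.re_ofReal_mul]
  have hscale : P * ((2 * Real.pi * √n) ^ d)⁻¹ = (2 * Real.pi) ^ (-((d : ℝ) / 2)) := by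
    rw [hP, Real.mul_rpow (by positivity) hn0.le, mul_pow, Real.sqrt_eq_rpow, ← Real.rpow_natCast,
      ← Real.rpow_natCast ((n : ℝ) ^ (1 / 2 : ℝ)), ← Real.rpow_mul hn0.le, mul_inv,
      ← Real.rpow_neg (by positivity), ← Real.rpow_neg (by positivity)]
    calc (2 * Real.pi) ^ ((d : ℝ) / 2) * (n : ℝ) ^ ((d : ℝ) / 2) *
          ((2 * Real.pi) ^ (-(d : ℝ)) * (n : ℝ) ^ (-(1 / 2 * (d : ℝ))))
        = ((2 * Real.pi) ^ ((d : ℝ) / 2) * (2 * Real.pi) ^ (-(d : ℝ))) *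
          ((n : ℝ) ^ ((d : ℝ) / 2) * (n : ℝ) ^ (-(1 / 2 * (d : ℝ)))) := by ring
      _ = _ := by
          rw [← Real.rpow_add (by positivity), ← Real.rpow_add hn0]
          have e1 : (d : ℝ) / 2 + -(d : ℝ) = -((d : ℝ) / 2) := by ring
          have e2 : (d : ℝ) / 2 + -(1 / 2 * (d : ℝ)) = 0 := by ring
          rw [e1, e2, Real.rpow_zero, mul_one]
  have hPn : P * γ ^ n ≤ (2 * Real.pi) ^ ((d : ℝ) / 2) * C₂ * (n : ℝ)⁻¹ := by
    have e1 : (n : ℝ) ^ ((d : ℝ) / 2) ≤ (n : ℝ) ^ d := by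
      rw [← Real.rpow_natCast]
      exact Real.rpow_le_rpow_of_exponent_le hn1 (by linarith [(Nat.cast_nonneg d : (0 : ℝ) ≤ d)])
    have e2 : (n : ℝ) ^ d * γ ^ n ≤ C₂ * (n : ℝ)⁻¹ := by
      rw [← div_eq_mul_inv, le_div_iff₀ hn0]
      calc _ = (n : ℝ) ^ (d + 1) * γ ^ n := by ring
        _ ≤ C₂ := hexp n
    rw [hP, Real.mul_rpow (by positivity) hn0.le, mul_assoc, mul_assoc]
    refine mul_le_mul_of_nonneg_left (le_trans ?_ e2) (by positivity)
    gcongr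
  set s := (2 * Real.pi) ^ (-((d : ℝ) / 2)) with hs
  have hs0 : 0 ≤ s := by positivity
  have hs1 : s * (2 * Real.pi) ^ ((d : ℝ) / 2) = 1 := by
    rw [hs, ← Real.rpow_add (by positivity)]
    simp
  -- Exponentially small part away from the peaks, plus the local error near the origin.
  have h4 : P * W'.prob n x - W.period * D =
      P * (W'.prob n x - W.period * (((2 * Real.pi * √n) ^ d)⁻¹ * J.re)) +
        W.period * (s * (J.re - (2 * Real.pi) ^ ((d : ℝ) / 2) * D)) := by
    linear_combination (W.period * J.re : ℝ) * hscale + (W.period * D) * hs1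
  rw [h4]
  refine (abs_add_le _ _).trans ?_
  rw [abs_mul, abs_mul, abs_mul, abs_of_nonneg hP0, abs_of_nonneg hs0,
    abs_of_nonneg (Nat.cast_nonneg W.period : (0 : ℝ) ≤ W.period)]
  calc _ ≤ P * γ ^ n + W.period * (s * (C₁ * (n : ℝ)⁻¹)) := by gcongr
    _ ≤ (2 * Real.pi) ^ ((d : ℝ) / 2) * C₂ * (n : ℝ)⁻¹ + W.period * (s * (C₁ * (n : ℝ)⁻¹)) := by
        gcongr
    _ = _ := by ring

end LatticeWalk

/-! ### Exponential tilting and the derivatives of `log κ`. -/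

namespace LatticeWalk

variable {d : ℕ}

theorem inner_toSpace (s : EuclideanSpace ℝ (Fin d)) (v : Fin d → ℤ) :
    ⟪s, toSpace v⟫ = ∑ i, s i * (v i : ℝ) := by
  simp [PiLp.inner_apply, toSpace, mul_comm]

theorem kappa_pos (W : LatticeWalk d) (s : EuclideanSpace ℝ (Fin d)) : 0 < W.kappa s :=
  Finset.sum_pos (fun _ hv => mul_pos (W.step_pos hv) (Real.exp_pos _)) W.support_nonempty

theorem kappa_zero (W : LatticeWalk d) : W.kappa 0 = 1 := by
  simp [kappa, W.sum_step]

theorem step_mul_exp_le_kappa (W : LatticeWalk d) (s : EuclideanSpace ℝ (Fin d))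
    {v : Fin d → ℤ} (hv : v ∈ W.step.support) :
    W.step v * Real.exp ⟪s, toSpace v⟫ ≤ W.kappa s :=
  Finset.single_le_sum (f := fun v => W.step v * Real.exp ⟪s, toSpace v⟫)
    (fun v _ => mul_nonneg (W.step_nonneg v) (Real.exp_pos _).le) hv

/-- The exponentially tilted walk, with step distribution `p(v) e^{⟨s, v⟩} / κ(s)`. -/
noncomputable def tilt (W : LatticeWalk d) (s : EuclideanSpace ℝ (Fin d)) : LatticeWalk d where
  step := Finsupp.onFinset W.step.support
    (fun v => W.step v * Real.exp ⟪s, toSpace v⟫ / W.kappa s) fun v hv => by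
      rw [Finsupp.mem_support_iff]
      intro h
      simp [h] at hv
  step_nonneg v := div_nonneg (mul_nonneg (W.step_nonneg v) (Real.exp_pos _).le) (W.kappa_pos s).le
  sum_step := by
    rw [Finset.sum_subset Finsupp.support_onFinset_subset fun v _ hv =>
      Finsupp.notMem_support_iff.mp hv]
    simp only [Finsupp.onFinset_apply]
    rw [← Finset.sum_div]
    exact div_self (W.kappa_pos s).ne'

theorem tilt_step (W : LatticeWalk d) (s : EuclideanSpace ℝ (Fin d)) (v : Fin d → ℤ) :
    (W.tilt s).step v = W.step v * Real.exp ⟪s, toSpace v⟫ / W.kappa s := rfl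

theorem support_tilt (W : LatticeWalk d) (s : EuclideanSpace ℝ (Fin d)) :
    (W.tilt s).step.support = W.step.support := by
  ext v
  simp [tilt_step, (W.kappa_pos s).ne', (Real.exp_pos _).ne']

/-- The weight `e^{⟨s, v⟩}` is multiplicative along a path, so it depends only on the endpoint and
the length. -/
theorem prob_tilt (W : LatticeWalk d) (s : EuclideanSpace ℝ (Fin d)) (n : ℕ) (x : Fin d → ℤ) :
    (W.tilt s).prob n x = W.prob n x * Real.exp ⟪s, toSpace x⟫ / W.kappa s ^ n := by
  have hκ := (W.kappa_pos s).ne'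
  induction n generalizing x with
  | zero =>
    rw [prob_zero, prob_zero]
    split_ifs with h
    · simp [h, inner_toSpace]
    · simp
  | succ n ih =>
    rw [prob_succ, prob_succ, support_tilt, Finset.sum_mul, Finset.sum_div]
    refine Finset.sum_congr rfl fun v _ => ?_
    have h : Real.exp ⟪s, toSpace x⟫ =
        Real.exp ⟪s, toSpace v⟫ * Real.exp ⟪s, toSpace (x - v)⟫ := by
      rw [← Real.exp_add]
      simp [inner_toSpace, mul_sub]
    rw [ih, tilt_step, h]
    field_simp
    ring

/-- Moments of the step distribution weighted with `e^{⟨s, v⟩}`. -/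
noncomputable def expSum (W : LatticeWalk d) (c : (Fin d → ℤ) → ℝ)
    (s : EuclideanSpace ℝ (Fin d)) : ℝ :=
  ∑ v ∈ W.step.support, W.step v * Real.exp ⟪s, toSpace v⟫ * c v

theorem sum_tilt_step_mul (W : LatticeWalk d) (s : EuclideanSpace ℝ (Fin d))
    (c : (Fin d → ℤ) → ℝ) :
    ∑ v ∈ (W.tilt s).step.support, (W.tilt s).step v * c v = W.expSum c s / W.kappa s := by
  rw [support_tilt, expSum, Finset.sum_div]
  exact Finset.sum_congr rfl fun v _ => by rw [tilt_step]; ring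

theorem kappa_eq_expSum (W : LatticeWalk d) : W.kappa = W.expSum fun _ => 1 := by
  ext s; simp [kappa, expSum]

theorem contDiff_expSum (W : LatticeWalk d) (c : (Fin d → ℤ) → ℝ) :
    ContDiff ℝ 1 (W.expSum c) := by
  unfold expSum
  exact ContDiff.sum fun v _ =>
    (contDiff_const.mul (contDiff_id.inner ℝ contDiff_const).exp).mul contDiff_const

theorem contDiff_kappa (W : LatticeWalk d) : ContDiff ℝ 1 W.kappa := by
  rw [kappa_eq_expSum]; exact W.contDiff_expSum _

theorem mean_tilt (W : LatticeWalk d) (s : EuclideanSpace ℝ (Fin d)) (i : Fin d) :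
    (W.tilt s).mean i = W.expSum (fun v => v i) s / W.kappa s :=
  W.sum_tilt_step_mul s fun v => v i

theorem cov_tilt (W : LatticeWalk d) (s : EuclideanSpace ℝ (Fin d)) (i j : Fin d) :
    (W.tilt s).cov i j = W.expSum (fun v => v i * v j) s / W.kappa s -
      W.expSum (fun v => v i) s / W.kappa s * (W.expSum (fun v => v j) s / W.kappa s) := by
  rw [← mean_tilt, ← mean_tilt, ← sum_tilt_step_mul]
  rfl

theorem hasLineDerivAt_expSum (W : LatticeWalk d) (c : (Fin d → ℤ) → ℝ)
    (s u : EuclideanSpace ℝ (Fin d)) :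
    HasLineDerivAt ℝ (W.expSum c) (W.expSum (fun v => c v * ⟪u, toSpace v⟫) s) s u := by
  unfold HasLineDerivAt expSum
  refine HasDerivAt.fun_sum fun v _ => ?_
  have h1 : HasDerivAt (fun t : ℝ => ⟪s + t • u, toSpace v⟫) ⟪u, toSpace v⟫ 0 := by
    simp only [inner_add_left, real_inner_smul_left]
    simpa using ((hasDerivAt_id (0 : ℝ)).mul_const ⟪u, toSpace v⟫).const_add ⟪s, toSpace v⟫
  have h2 := (h1.exp.const_mul (W.step v)).mul_const (c v)
  simp only [zero_smul, add_zero] at h2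
  exact h2.congr_deriv (by ring)

theorem inner_single_toSpace (i : Fin d) (v : Fin d → ℤ) :
    ⟪EuclideanSpace.single i (1 : ℝ), toSpace v⟫ = (v i : ℝ) := by
  simp [toSpace, EuclideanSpace.inner_single_left]

theorem hasLineDerivAt_log_kappa (W : LatticeWalk d) (s : EuclideanSpace ℝ (Fin d)) (i : Fin d) :
    HasLineDerivAt ℝ (fun z => Real.log (W.kappa z)) ((W.tilt s).mean i) s
      (EuclideanSpace.single i 1) := by
  have h := W.hasLineDerivAt_expSum (fun _ => 1) s (EuclideanSpace.single i 1)
  rw [← kappa_eq_expSum] at h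
  have h0 : W.kappa (s + (0 : ℝ) • EuclideanSpace.single i 1) ≠ 0 := (W.kappa_pos _).ne'
  have h2 := HasDerivAt.log h h0
  simp only [inner_single_toSpace, one_mul, zero_smul, add_zero] at h2
  rw [mean_tilt]
  exact h2

/-- The gradient of `log κ` is the tilted mean, a quotient of exponential sums; differentiating once
more gives the tilted covariance. -/
theorem form_single (W : LatticeWalk d) (s : EuclideanSpace ℝ (Fin d)) (i j : Fin d) :
    W.form s (EuclideanSpace.single i 1) (EuclideanSpace.single j 1) = (W.tilt s).cov i j := by
  have h1 : (fun y => lineDeriv ℝ (fun z => Real.log (W.kappa z)) y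
      (EuclideanSpace.single j (1 : ℝ))) =
      fun y => W.expSum (fun v => v j) y / W.kappa y := by
    ext y
    rw [(W.hasLineDerivAt_log_kappa y j).lineDeriv, mean_tilt]
  rw [form, h1]
  apply HasLineDerivAt.lineDeriv
  have hN := W.hasLineDerivAt_expSum (fun v => v j) s (EuclideanSpace.single i 1)
  have hD := W.hasLineDerivAt_expSum (fun _ => 1) s (EuclideanSpace.single i 1)
  rw [← kappa_eq_expSum] at hD
  have h0 : W.kappa (s + (0 : ℝ) • EuclideanSpace.single i 1) ≠ 0 := (W.kappa_pos _).ne'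
  have h2 := HasDerivAt.fun_div hN hD h0
  simp only [inner_single_toSpace, one_mul, zero_smul, add_zero] at h2
  unfold HasLineDerivAt
  refine HasDerivAt.congr_deriv h2 ?_
  rw [cov_tilt]
  have hκ := (W.kappa_pos s).ne'
  have hcomm : (fun v : Fin d → ℤ => (v i : ℝ) * v j) = fun v => (v j : ℝ) * v i := by
    ext v; ring
  rw [hcomm]
  field_simp

theorem formDet_eq (W : LatticeWalk d) (s : EuclideanSpace ℝ (Fin d)) :
    W.formDet s = (W.tilt s).cov.det := by
  rw [formDet]
  congr 1
  ext i j
  exact W.form_single s i j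

theorem contDiff_formDet (W : LatticeWalk d) : ContDiff ℝ 1 W.formDet := by
  have h : W.formDet = fun s => (W.tilt s).cov.det := funext W.formDet_eq
  rw [h]
  simp only [Matrix.det_apply, cov_tilt]
  refine ContDiff.sum fun σ _ => ContDiff.const_smul _ (contDiff_prod fun i _ => ?_)
  have hκ : ∀ s, W.kappa s ≠ 0 := fun s => (W.kappa_pos s).ne'
  have hdiv : ∀ c, ContDiff ℝ 1 fun s => W.expSum c s / W.kappa s := fun c =>
    (W.contDiff_expSum c).fun_div W.contDiff_kappa hκ
  exact (hdiv _).sub ((hdiv _).mul (hdiv _))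

theorem exists_abs_sub_le_of_contDiff {E : Type*} [NormedAddCommGroup E] [NormedSpace ℝ E]
    [FiniteDimensional ℝ E] {f : E → ℝ} (hf : ContDiff ℝ 1 f) (R : ℝ) :
    ∃ L : ℝ, 0 ≤ L ∧ ∀ s, ‖s‖ ≤ R → |f s - f 0| ≤ L * ‖s‖ := by
  obtain ⟨L, hL⟩ := (isCompact_closedBall (0 : E) R).exists_bound_of_continuousOn
    (hf.continuous_fderiv one_ne_zero).continuousOn
  refine ⟨max L 0, le_max_right _ _, fun s hs => ?_⟩
  have hR : 0 ≤ R := (norm_nonneg s).trans hs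
  have h := (convex_closedBall (0 : E) R).norm_image_sub_le_of_norm_fderiv_le (𝕜 := ℝ) (f := f)
    (fun y _ => (hf.differentiable one_ne_zero) y) (fun y hy => (hL y hy).trans (le_max_left L 0))
    (Metric.mem_closedBall_self hR) (by simpa using hs)
  simpa using h

end LatticeWalk

/-! ### The region, the Legendre transform and the size of the tilt. -/

namespace LatticeWalk

variable {d : ℕ}

/-- The ball is connected, meets `U` and misses its frontier. -/
theorem ball_subset_of_le_infDist_frontier {E : Type*} [NormedAddCommGroup E] [NormedSpace ℝ E]
    {U : Set E} (hU : IsOpen U) {δ : E} (hδ : δ ∈ U) {ε : ℝ} (hε : 0 < ε)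
    (h : ε ≤ Metric.infDist δ (frontier U)) : Metric.ball δ ε ⊆ U := by
  refine (convex_ball δ ε).isPreconnected.subset_left_of_subset_union hU
    isClosed_closure.isOpen_compl (v := (closure U)ᶜ)
    (Set.disjoint_compl_right_iff_subset.mpr subset_closure) (fun z hz => ?_)
    ⟨δ, Metric.mem_ball_self hε, hδ⟩
  by_contra hn
  simp only [Set.mem_union, Set.mem_compl_iff, not_or, not_not] at hn
  have hz' : z ∈ frontier U := by
    rw [frontier, hU.interior_eq]; exact ⟨hn.2, hn.1⟩
  have := Metric.infDist_le_dist_of_mem (x := δ) hz'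
  rw [Metric.mem_ball, dist_comm] at hz
  linarith

theorem prob_eq_zero_of_notMem_region (W : LatticeWalk d) {ε : ℝ} (hε : 0 < ε) {n : ℕ}
    (hn : 1 ≤ n) {x : Fin d → ℤ} {δ : EuclideanSpace ℝ (Fin d)}
    (hδ : δ = (n : ℝ)⁻¹ • toSpace x) (h : ε ≤ Metric.infDist δ (frontier W.region))
    (hmem : δ ∉ W.region) : W.prob n x = 0 := by
  by_contra h0
  have h1 := W.inv_smul_mem_convexHull hn ((W.prob_nonneg n x).lt_of_ne' h0)
  rw [← hδ] at h1
  -- `Metric.infDist` to the empty set is `0`, so the hypothesis excludes an empty region. The hull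
  -- then lies in the closure of its interior, and `δ` would be a frontier point.
  have hne : W.region.Nonempty := by
    rw [Set.nonempty_iff_ne_empty]
    intro he
    rw [he, frontier_empty, Metric.infDist_empty] at h
    linarith
  have h2 : δ ∈ closure W.region := by
    rw [region, (convex_convexHull ℝ _).closure_interior_eq_closure_of_nonempty_interior hne]
    exact subset_closure h1
  have h3 : δ ∈ frontier W.region := by
    rw [frontier, region, interior_interior]
    exact ⟨h2, hmem⟩
  rw [Metric.infDist_zero_of_mem h3] at h
  linarith

/-- Otherwise the whole hull lies in an open half-space that excludes `δ + (ε/2) u/‖u‖`, a point of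
the ball. -/
theorem exists_le_inner_sub (W : LatticeWalk d) {δ : EuclideanSpace ℝ (Fin d)} {ε : ℝ}
    (hε : 0 < ε) (hball : Metric.ball δ ε ⊆ W.region) (u : EuclideanSpace ℝ (Fin d)) :
    ∃ v ∈ W.step.support, ⟪u, δ⟫ + ε / 2 * ‖u‖ ≤ ⟪u, toSpace v⟫ := by
  by_contra! hcon
  by_cases hu : u = 0
  · obtain ⟨v, hv⟩ := W.support_nonempty
    simpa [hu] using hcon v hv
  have hn : 0 < ‖u‖ := norm_pos_iff.mpr hu
  set z := δ + (ε / 2 * ‖u‖⁻¹) • u with hz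
  have hzmem : z ∈ Metric.ball δ ε := by
    rw [hz, mem_ball_iff_norm, add_sub_cancel_left, norm_smul, Real.norm_of_nonneg (by positivity),
      mul_assoc, inv_mul_cancel₀ hn.ne']
    linarith
  have hhull : convexHull ℝ (toSpace '' {v : Fin d → ℤ | 0 < W.step v}) ⊆
      {y | ⟪u, y⟫ < ⟪u, δ⟫ + ε / 2 * ‖u‖} := by
    refine convexHull_min ?_ (convex_halfSpace_lt (innerₛₗ ℝ u).isLinear _)
    rintro _ ⟨v, hv, rfl⟩
    exact hcon v (Finsupp.mem_support_iff.mpr (ne_of_gt hv))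
  have h1 : ⟪u, z⟫ < ⟪u, δ⟫ + ε / 2 * ‖u‖ := hhull (interior_subset (hball hzmem))
  rw [hz, inner_add_right, real_inner_smul_right, real_inner_self_eq_norm_sq] at h1
  have : ε / 2 * ‖u‖⁻¹ * ‖u‖ ^ 2 = ε / 2 * ‖u‖ := by field_simp
  linarith

theorem exists_step_lower_bound (W : LatticeWalk d) :
    ∃ p : ℝ, 0 < p ∧ p ≤ 1 ∧ ∀ v ∈ W.step.support, p ≤ W.step v := by
  obtain ⟨v₀, hv₀, hmin⟩ := W.step.support.exists_min_image W.step W.support_nonempty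
  refine ⟨W.step v₀, W.step_pos hv₀, ?_, hmin⟩
  rw [← W.sum_step]
  exact Finset.single_le_sum (f := W.step) (fun v _ => W.step_nonneg v) hv₀

/-- The Legendre transform at an interior point is attained, at a point whose norm is bounded in
terms of the distance to the boundary. -/
theorem exists_maximizer (W : LatticeWalk d) {ε : ℝ} (hε : 0 < ε) :
    ∃ R : ℝ, 0 ≤ R ∧ ∀ δ, Metric.ball δ ε ⊆ W.region → ∃ s : EuclideanSpace ℝ (Fin d),
      ‖s‖ ≤ R ∧ ∀ u, ⟪u, δ⟫ - Real.log (W.kappa u) ≤ ⟪s, δ⟫ - Real.log (W.kappa s) := by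
  obtain ⟨p, hp0, hp1, hp⟩ := W.exists_step_lower_bound
  have hlog : Real.log p ≤ 0 := Real.log_nonpos hp0.le hp1
  have hR : 0 ≤ -Real.log p / (ε / 2) := div_nonneg (by linarith) (by positivity)
  refine ⟨-Real.log p / (ε / 2), hR, fun δ hball => ?_⟩
  have hcont : Continuous fun u : EuclideanSpace ℝ (Fin d) => ⟪u, δ⟫ - Real.log (W.kappa u) :=
    (continuous_id.inner continuous_const).sub
      (W.contDiff_kappa.continuous.log fun s => (W.kappa_pos s).ne')
  -- Keeping a single term of `κ` shows that the objective is negative beyond the chosen radius,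
  -- hence below its value `0` at the origin.
  have hle : ∀ u : EuclideanSpace ℝ (Fin d),
      ⟪u, δ⟫ - Real.log (W.kappa u) ≤ -Real.log p - ε / 2 * ‖u‖ := by
    intro u
    obtain ⟨v, hv, hu⟩ := W.exists_le_inner_sub hε hball u
    have h1 : p * Real.exp ⟪u, toSpace v⟫ ≤ W.kappa u :=
      (mul_le_mul_of_nonneg_right (hp v hv) (Real.exp_pos _).le).trans
        (W.step_mul_exp_le_kappa u hv)
    have h2 := Real.log_le_log (by positivity) h1
    rw [Real.log_mul hp0.ne' (Real.exp_pos _).ne', Real.log_exp] at h2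
    linarith
  obtain ⟨s, hs, hmax⟩ := (isCompact_closedBall (0 : EuclideanSpace ℝ (Fin d))
    (-Real.log p / (ε / 2))).exists_isMaxOn ⟨0, Metric.mem_closedBall_self hR⟩ hcont.continuousOn
  refine ⟨s, by simpa using hs, fun u => ?_⟩
  by_cases hu : ‖u‖ ≤ -Real.log p / (ε / 2)
  · exact hmax (by simpa using hu)
  · have h0 := hmax (Metric.mem_closedBall_self hR)
    simp only [Set.mem_ofPred_eq, inner_zero_left, kappa_zero, Real.log_one, sub_zero] at h0
    rw [not_le, div_lt_iff₀ (by positivity)] at hu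
    linarith [hle u]

theorem mean_tilt_of_isMax (W : LatticeWalk d) {δ s : EuclideanSpace ℝ (Fin d)}
    (h : ∀ u, ⟪u, δ⟫ - Real.log (W.kappa u) ≤ ⟪s, δ⟫ - Real.log (W.kappa s)) (i : Fin d) :
    (W.tilt s).mean i = δ i := by
  have h1 : HasDerivAt (fun t : ℝ => ⟪s + t • EuclideanSpace.single i (1 : ℝ), δ⟫) (δ i) 0 := by
    simp only [inner_add_left, real_inner_smul_left, EuclideanSpace.inner_single_left]
    simpa using ((hasDerivAt_id (0 : ℝ)).mul_const (δ i)).const_add ⟪s, δ⟫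
  have h2 := h1.sub (W.hasLineDerivAt_log_kappa s i)
  have hmax : IsLocalMax ((fun t : ℝ => ⟪s + t • EuclideanSpace.single i (1 : ℝ), δ⟫) -
      fun t : ℝ => Real.log (W.kappa (s + t • EuclideanSpace.single i (1 : ℝ)))) 0 :=
    Filter.Eventually.of_forall fun t => by
      simpa using h (s + t • EuclideanSpace.single i (1 : ℝ))
  have := hmax.hasDerivAt_eq_zero h2
  linarith

theorem exists_abs_inner_le (W : LatticeWalk d) {R : ℝ} (hR : 0 ≤ R) :
    ∃ M : ℝ, 0 ≤ M ∧ ∀ s : EuclideanSpace ℝ (Fin d), ‖s‖ ≤ R → ∀ v ∈ W.step.support,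
      |⟪s, toSpace v⟫| ≤ M := by
  refine ⟨R * ∑ v ∈ W.step.support, ‖toSpace v‖, by positivity, fun s hs v hv => ?_⟩
  refine (abs_real_inner_le_norm _ _).trans (mul_le_mul hs ?_ (norm_nonneg _) hR)
  exact Finset.single_le_sum (f := fun v => ‖toSpace v‖) (fun _ _ => norm_nonneg _) hv

theorem kappa_le_exp (W : LatticeWalk d) {M : ℝ} {s : EuclideanSpace ℝ (Fin d)}
    (h : ∀ v ∈ W.step.support, |⟪s, toSpace v⟫| ≤ M) : W.kappa s ≤ Real.exp M := by
  calc W.kappa s ≤ ∑ v ∈ W.step.support, W.step v * Real.exp M :=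
        Finset.sum_le_sum fun v hv => mul_le_mul_of_nonneg_left
          (Real.exp_le_exp.mpr ((le_abs_self _).trans (h v hv))) (W.step_nonneg v)
    _ = Real.exp M := by rw [← Finset.sum_mul, W.sum_step, one_mul]

/-- Supplies the lower bound `q` that makes the local limit theorem uniform over bounded tilts. -/
theorem le_tilt_step (W : LatticeWalk d) {M p : ℝ} (hp0 : 0 ≤ p)
    (hp : ∀ v ∈ W.step.support, p ≤ W.step v) {s : EuclideanSpace ℝ (Fin d)}
    (h : ∀ v ∈ W.step.support, |⟪s, toSpace v⟫| ≤ M) {v : Fin d → ℤ} (hv : v ∈ W.step.support) :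
    p * Real.exp (-M) / Real.exp M ≤ (W.tilt s).step v := by
  rw [tilt_step]
  have := W.kappa_le_exp h
  have hκ := W.kappa_pos s
  have h1 := hp v hv
  have h2 : Real.exp (-M) ≤ Real.exp ⟪s, toSpace v⟫ :=
    Real.exp_le_exp.mpr (abs_le.mp (h v hv)).1
  have h3 := W.step_nonneg v
  gcongr

theorem mul_sub_sq_le_exp {M a b : ℝ} (ha : |a| ≤ M) (hb : |b| ≤ M) :
    Real.exp (-M) * (a - b) ^ 2 ≤ (a - b) * (Real.exp a - Real.exp b) := by
  wlog hab : b ≤ a generalizing a b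
  · have := this hb ha (le_of_not_ge hab)
    linarith [this, show (b - a) ^ 2 = (a - b) ^ 2 by ring]
  have h1 : Real.exp a = Real.exp b * Real.exp (a - b) := by rw [← Real.exp_add]; congr 1; ring
  have h2 := Real.add_one_le_exp (a - b)
  have h3 : Real.exp (-M) ≤ Real.exp b := Real.exp_le_exp.mpr (abs_le.mp hb).1
  have h4 : Real.exp (-M) * (a - b) ≤ Real.exp a - Real.exp b := by
    calc Real.exp (-M) * (a - b) ≤ Real.exp b * (Real.exp (a - b) - 1) :=
          mul_le_mul h3 (by linarith) (by linarith) (Real.exp_pos _).le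
      _ = Real.exp a - Real.exp b := by rw [h1]; ring
  nlinarith [mul_le_mul_of_nonneg_left h4 (sub_nonneg.mpr hab)]

theorem sum_sum_mul_sub_mul_sub {ι : Type*} {V : Finset ι} {w : ι → ℝ} (a b : ι → ℝ)
    (hw1 : ∑ v ∈ V, w v = 1) :
    ∑ v ∈ V, ∑ v' ∈ V, w v * w v' * ((a v - a v') * (b v - b v')) =
      2 * (∑ v ∈ V, w v * (a v * b v) - (∑ v ∈ V, w v * a v) * ∑ v ∈ V, w v * b v) := by
  have h1 : ∀ v v', w v * w v' * ((a v - a v') * (b v - b v')) =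
      (w v * (a v * b v)) * w v' + w v * (w v' * (a v' * b v')) -
        (w v * a v) * (w v' * b v') - (w v * b v) * (w v' * a v') :=
    fun _ _ => by ring
  simp only [h1, Finset.sum_sub_distrib, Finset.sum_add_distrib, ← Finset.mul_sum,
    ← Finset.sum_mul, hw1]
  ring

/-- Strong monotonicity of the gradient of `log κ` between `0` and `s`. -/
theorem variance_le_sum_mul_mean_sub (W : LatticeWalk d) {M : ℝ} {s : EuclideanSpace ℝ (Fin d)}
    (h : ∀ v ∈ W.step.support, |⟪s, toSpace v⟫| ≤ M) :
    Real.exp (-M) / Real.exp M * ∑ v ∈ W.step.support, W.step v * W.dev s v ^ 2 ≤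
      ∑ i, s i * ((W.tilt s).mean i - W.mean i) := by
  have hκ := W.kappa_pos s
  set a : (Fin d → ℤ) → ℝ := fun v => ⟪s, toSpace v⟫ with ha
  have hmean : ∀ W' : LatticeWalk d, ∑ i, s i * W'.mean i =
      ∑ v ∈ W'.step.support, W'.step v * a v := by
    intro W'
    simp only [mean, Finset.mul_sum, ha, inner_toSpace]
    rw [Finset.sum_comm]
    exact Finset.sum_congr rfl fun v _ => Finset.sum_congr rfl fun i _ => by ring
  -- The left side is the covariance of `a` and `exp a` under `p`, divided by `κ(s)`. As a double
  -- sum over pairs of steps it is compared termwise with the variance of `a`.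
  have h1 : ∑ i, s i * ((W.tilt s).mean i - W.mean i) = (∑ v ∈ W.step.support, ∑ v' ∈ W.step.support,
      W.step v * W.step v' * ((a v - a v') * (Real.exp (a v) - Real.exp (a v')))) /
        (2 * W.kappa s) := by
    rw [sum_sum_mul_sub_mul_sub a (fun v => Real.exp (a v)) W.sum_step]
    simp only [mul_sub, Finset.sum_sub_distrib]
    rw [hmean, hmean, sum_tilt_step_mul]
    have e1 : W.expSum a s = ∑ v ∈ W.step.support, W.step v * (a v * Real.exp (a v)) :=
      Finset.sum_congr rfl fun v _ => by simp only [ha]; ring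
    have e2 : W.kappa s = ∑ v ∈ W.step.support, W.step v * Real.exp (a v) := rfl
    rw [e1, ← e2]
    field_simp
  have h2 : ∑ v ∈ W.step.support, W.step v * W.dev s v ^ 2 = (∑ v ∈ W.step.support,
      ∑ v' ∈ W.step.support, W.step v * W.step v' * (a v - a v') ^ 2) / 2 := by
    have e := sum_sum_mul_sub_sq (a := W.dev s) W.sum_step
    rw [sum_step_mul_dev] at e
    have e3 : ∀ v v', W.dev s v - W.dev s v' = a v - a v' := fun v v' => by
      simp only [dev_eq, ha, inner_toSpace]; ring
    simp only [e3] at e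
    rw [e]; ring
  have h3 : Real.exp (-M) * ∑ v ∈ W.step.support,
      ∑ v' ∈ W.step.support, W.step v * W.step v' * (a v - a v') ^ 2 ≤
      ∑ v ∈ W.step.support, ∑ v' ∈ W.step.support,
        W.step v * W.step v' * ((a v - a v') * (Real.exp (a v) - Real.exp (a v'))) := by
    simp only [Finset.mul_sum]
    refine Finset.sum_le_sum fun v hv => Finset.sum_le_sum fun v' hv' => ?_
    have := mul_le_mul_of_nonneg_left (mul_sub_sq_le_exp (h v hv) (h v' hv'))
      (mul_nonneg (W.step_nonneg v) (W.step_nonneg v'))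
    linarith
  rw [h1, h2]
  have hS : 0 ≤ ∑ v ∈ W.step.support,
      ∑ v' ∈ W.step.support, W.step v * W.step v' * (a v - a v') ^ 2 :=
    Finset.sum_nonneg fun v _ => Finset.sum_nonneg fun v' _ =>
      mul_nonneg (mul_nonneg (W.step_nonneg v) (W.step_nonneg v')) (sq_nonneg _)
  calc _ = (Real.exp (-M) * ∑ v ∈ W.step.support,
      ∑ v' ∈ W.step.support, W.step v * W.step v' * (a v - a v') ^ 2) / (2 * Real.exp M) := by
        field_simp
    _ ≤ _ := div_le_div₀ ((mul_nonneg (Real.exp_pos _).le hS).trans h3) h3 (by positivity)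
        (mul_le_mul_of_nonneg_left (W.kappa_le_exp h) (by norm_num))

theorem norm_le_mul_norm_ofLp (s : EuclideanSpace ℝ (Fin d)) : ‖s‖ ≤ (d + 1) * ‖s.ofLp‖ := by
  refine abs_le_of_sq_le_sq' ?_ (by positivity) |>.2
  rw [EuclideanSpace.real_norm_sq_eq]
  calc ∑ i, s i ^ 2 ≤ ∑ _i : Fin d, ‖s.ofLp‖ ^ 2 := Finset.sum_le_sum fun i _ => by
        rw [← sq_abs]; exact pow_le_pow_left₀ (abs_nonneg _) (norm_le_pi_norm s.ofLp i) 2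
    _ = d * ‖s.ofLp‖ ^ 2 := by simp
    _ ≤ _ := by
        rw [mul_pow]
        refine mul_le_mul_of_nonneg_right ?_ (sq_nonneg _)
        nlinarith [(Nat.cast_nonneg d : (0 : ℝ) ≤ d)]

/-- The tilt parameter depends Lipschitz continuously on the mean, at the mean step. -/
theorem exists_norm_le_norm1 (W : LatticeWalk d) (hW : W.Irred) {M : ℝ} :
    ∃ C : ℝ, 0 ≤ C ∧ ∀ s : EuclideanSpace ℝ (Fin d),
      (∀ v ∈ W.step.support, |⟪s, toSpace v⟫| ≤ M) → ∀ δ : EuclideanSpace ℝ (Fin d),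
      (∀ i, (W.tilt s).mean i = δ i) → ‖s‖ ≤ C * norm1 (δ - W.meanStep) := by
  obtain ⟨p, hp0, -, hp⟩ := W.exists_step_lower_bound
  obtain ⟨c, hc0, hc⟩ := W.exists_le_sum_dev_sq hW hp0
  set k := Real.exp (-M) / Real.exp M * c with hk
  have hk0 : 0 < k := by positivity
  refine ⟨(d + 1) * k⁻¹, by positivity, fun s hs δ hδ => ?_⟩
  have h1 := W.variance_le_sum_mul_mean_sub hs
  have h2 := hc W rfl hp s
  have hmean : ∀ i, W.meanStep i = W.mean i := fun i => by simp [meanStep, mean, toSpace]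
  have h3 : ∑ i, s i * ((W.tilt s).mean i - W.mean i) ≤
      ‖s.ofLp‖ * norm1 (δ - W.meanStep) := by
    rw [norm1, Finset.mul_sum]
    refine Finset.sum_le_sum fun i _ => ?_
    rw [hδ, ← hmean]
    refine (le_abs_self _).trans ?_
    rw [abs_mul]
    exact mul_le_mul_of_nonneg_right (norm_le_pi_norm s.ofLp i) (abs_nonneg _)
  -- Quadratic lower bound against a linear upper bound; `s.ofLp` carries the sup norm, dual to
  -- `norm1`.
  have h4 : k * ‖s.ofLp‖ ^ 2 ≤ ‖s.ofLp‖ * norm1 (δ - W.meanStep) := by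
    refine le_trans ?_ (h1.trans h3)
    rw [hk, mul_assoc]
    exact mul_le_mul_of_nonneg_left h2 (by positivity)
  have hn1 : 0 ≤ norm1 (δ - W.meanStep) := Finset.sum_nonneg fun _ _ => abs_nonneg _
  have h5 : ‖s.ofLp‖ ≤ k⁻¹ * norm1 (δ - W.meanStep) := by
    rw [← div_eq_inv_mul, le_div_iff₀ hk0]
    rcases (norm_nonneg s.ofLp).eq_or_lt with h0 | h0
    · rw [← h0, zero_mul]; exact hn1
    · nlinarith
  calc ‖s‖ ≤ (d + 1) * ‖s.ofLp‖ := norm_le_mul_norm_ofLp s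
    _ ≤ (d + 1) * (k⁻¹ * norm1 (δ - W.meanStep)) := by gcongr
    _ = _ := by ring

theorem formDet_pos (W : LatticeWalk d) (hW : W.Irred) (s : EuclideanSpace ℝ (Fin d)) :
    0 < W.formDet s := by
  obtain ⟨p, hp0, -, hp⟩ := (W.tilt s).exists_step_lower_bound
  rw [support_tilt] at hp
  obtain ⟨c, hc0, hc⟩ := W.exists_le_sum_dev_sq hW hp0
  rw [formDet_eq]
  exact ((W.tilt s).posDef_cov_of_le hc0 (hc _ (W.support_tilt s) hp)).det_pos

end LatticeWalk

/-! ### Assembly of the estimates. -/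

theorem corollary3p2 (d : ℕ) (hd : 1 ≤ d) (W : LatticeWalk d) (hW : W.Irred) :
    ∀ ε : ℝ, 0 < ε → ∃ C : ℝ, 0 < C ∧
      ∀ j : ℕ, j < W.period → ∀ n : ℕ, 1 ≤ n → ∀ x ∈ W.cyclicClass j,
        ∀ δ : EuclideanSpace ℝ (Fin d), δ = (n : ℝ)⁻¹ • LatticeWalk.toSpace x →
          (n ≡ j [MOD W.period] → ε ≤ Metric.infDist δ (frontier W.region) →
            (δ ∈ W.region →
              IsGreatest
                (Set.range fun u : EuclideanSpace ℝ (Fin d) =>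
                  inner ℝ u δ - Real.log (W.kappa u)) (W.phi δ) ∧
              ∃ E₁ E₂ : ℝ,
                |E₁| ≤ C * LatticeWalk.norm1 (δ - W.meanStep) ∧
                |E₂| ≤ C * (n : ℝ)⁻¹ ∧
                W.prob n x =
                  (2 * Real.pi * n) ^ (-(d : ℝ) / 2) *
                    (W.formDet 0) ^ (-(1 : ℝ) / 2) *
                    Real.exp (-(n * W.phi δ)) * (W.period + E₁ + E₂)) ∧
            (δ ∉ W.region → W.prob n x = 0)) ∧
          (¬ n ≡ j [MOD W.period] → W.prob n x = 0) := by
  intro ε hε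
  obtain ⟨R, hR, hmax⟩ := W.exists_maximizer hε
  obtain ⟨M, -, hM⟩ := W.exists_abs_inner_le hR
  obtain ⟨p, hp0, -, hp⟩ := W.exists_step_lower_bound
  obtain ⟨C₁, hC₁, hlocal⟩ := W.exists_abs_prob_mul_sub_le hW
    (q := p * Real.exp (-M) / Real.exp M) (by positivity)
  obtain ⟨C₂, hC₂, hlip⟩ := W.exists_norm_le_norm1 hW (M := M)
  obtain ⟨L, hL, hdet⟩ := LatticeWalk.exists_abs_sub_le_of_contDiff
    (f := fun s => W.formDet s ^ (-(1 : ℝ) / 2))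
    (W.contDiff_formDet.rpow_const_of_ne fun s => (W.formDet_pos hW s).ne') R
  set D₀ := W.formDet 0 ^ (-(1 : ℝ) / 2) with hD₀
  have hD₀pos : 0 < D₀ := Real.rpow_pos_of_pos (W.formDet_pos hW 0) _
  -- The first summand bounds `E₁`, the second `E₂`; the `1` ensures positivity.
  refine ⟨W.period * (L * C₂) / D₀ + C₁ / D₀ + 1, by positivity, ?_⟩
  intro j _ n hn x hx δ hδ
  refine ⟨fun hmod hdist => ⟨fun hmem => ?_,
    W.prob_eq_zero_of_notMem_region hε hn hδ hdist⟩, W.prob_eq_zero_of_not_modEq hW hx⟩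
  have hn0 : (0 : ℝ) < n := by exact_mod_cast hn
  obtain ⟨s, hs, hsmax⟩ := hmax δ
    (LatticeWalk.ball_subset_of_le_infDist_frontier isOpen_interior hmem hε hdist)
  have hgreat : IsGreatest (Set.range fun u : EuclideanSpace ℝ (Fin d) =>
      inner ℝ u δ - Real.log (W.kappa u)) (inner ℝ s δ - Real.log (W.kappa s)) :=
    ⟨⟨s, rfl⟩, by rintro _ ⟨u, rfl⟩; exact hsmax u⟩
  have hphi : W.phi δ = inner ℝ s δ - Real.log (W.kappa s) := hgreat.csSup_eq
  refine ⟨hphi ▸ hgreat, ?_⟩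
  have hmean := W.mean_tilt_of_isMax hsmax
  have hx' : ∀ i, (x i : ℝ) = n * (W.tilt s).mean i := fun i => by
    rw [hmean, hδ]
    simp [LatticeWalk.toSpace, hn0.ne']
  obtain ⟨k, hk⟩ := hx
  have hmain := hlocal (W.tilt s) (W.support_tilt s)
    (fun v hv => W.le_tilt_step hp0.le hp (hM s hs) hv) _ n x hn hk
    (hmod.trans (by simp [Nat.ModEq])) hx'
  rw [← W.formDet_eq s] at hmain
  set Ds := W.formDet s ^ (-(1 : ℝ) / 2) with hDs
  set A := (2 * Real.pi * n) ^ ((d : ℝ) / 2) * (W.tilt s).prob n x with hA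
  have hn1 : 0 ≤ LatticeWalk.norm1 (δ - W.meanStep) := Finset.sum_nonneg fun _ _ => abs_nonneg _
  -- Chosen so that `r + E₁ + E₂ = A / D₀` exactly: `E₁` replaces the determinant at `s` by that at
  -- `0`, and `E₂` is the local limit error.
  refine ⟨W.period * (Ds - D₀) / D₀, (A - W.period * Ds) / D₀, ?_, ?_, ?_⟩
  · rw [abs_div, abs_mul, abs_of_pos hD₀pos, Nat.abs_cast]
    have h1 : |Ds - D₀| ≤ L * (C₂ * LatticeWalk.norm1 (δ - W.meanStep)) :=
      (hdet s hs).trans (mul_le_mul_of_nonneg_left (hlip s (hM s hs) δ hmean) hL)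
    calc W.period * |Ds - D₀| / D₀
        ≤ W.period * (L * (C₂ * LatticeWalk.norm1 (δ - W.meanStep))) / D₀ := by gcongr
      _ = W.period * (L * C₂) / D₀ * LatticeWalk.norm1 (δ - W.meanStep) := by ring
      _ ≤ _ := mul_le_mul_of_nonneg_right (by
          have : 0 ≤ C₁ / D₀ := by positivity
          linarith) hn1
  · rw [abs_div, abs_of_pos hD₀pos]
    calc |A - W.period * Ds| / D₀ ≤ C₁ * (n : ℝ)⁻¹ / D₀ := by gcongr
      _ = C₁ / D₀ * (n : ℝ)⁻¹ := by ring
      _ ≤ _ := mul_le_mul_of_nonneg_right (by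
          have : 0 ≤ W.period * (L * C₂) / D₀ := by positivity
          linarith) (by positivity)
  · have h1 : D₀ * (W.period + W.period * (Ds - D₀) / D₀ + (A - W.period * Ds) / D₀) = A := by
      field_simp
      ring
    have h2 : (2 * Real.pi * n) ^ (-(d : ℝ) / 2) * A = (W.tilt s).prob n x := by
      rw [hA, ← mul_assoc, ← Real.rpow_add (by positivity)]
      rw [show -(d : ℝ) / 2 + (d : ℝ) / 2 = 0 by ring, Real.rpow_zero, one_mul]
    have h3 : Real.exp (-(n * W.phi δ)) * (W.tilt s).prob n x = W.prob n x := by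
      have hκ := W.kappa_pos s
      have hinner : inner ℝ s (LatticeWalk.toSpace x) = n * inner ℝ s δ := by
        rw [hδ, real_inner_smul_right]
        field_simp
      have h4 : Real.exp (-(n * W.phi δ)) =
          W.kappa s ^ n * (Real.exp (n * inner ℝ s δ))⁻¹ := by
        rw [hphi, ← Real.exp_neg]
        conv_rhs => rw [← Real.exp_log hκ, ← Real.exp_nat_mul, ← Real.exp_add]
        congr 1
        ring
      rw [W.prob_tilt, h4, hinner]
      field_simp
    rw [← h3, ← h2]
    linear_combination (-((2 * Real.pi * n) ^ (-(d : ℝ) / 2) * Real.exp (-(n * W.phi δ)))) * h1
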